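/- For $n\in\mathbb{N}$, let $\mathcal{P}_d(\mathbb{Z}^n)$ be the family of all convex hulls $P\subseteq\mathbb{R}^n$ of finite non-empty subsets of $\mathbb{Z}^n$ (lattice polytopes) whose affine hull $\operatorname{aff}(P)$ has dimension $\dim P\le d$. For $P\in\mathcal{P}_d(\mathbb{Z}^n)$ the normalized $d$-dimensional volume $\operatorname{Vol}_d(P)$ is defined as follows: if $\dim P<d$, then $\operatorname{Vol}_d(P)=0$; if $\dim P=d$, then $\operatorname{Vol}_d(P)=d!\cdot\operatorname{vol}_d(T^{-1}(P))$, where $\operatorname{vol}_d$ is Lebesgue measure on $\mathbb{R}^d$ and $T\colon\mathbb{R}^d\to\operatorname{aff}(P)$ is any affine bijection with $T(\mathbb{Z}^d)=\operatorname{aff}(P)\cap\mathbb{Z}^n$ (the value does not depend on the choice of $T$). **Proposition.** Let $p$ be a prime number and let $d=p^t\le n$ with $t$ a non-negative integer. Let $P_1,\dots,P_m\in\mathcal{P}_d(\mathbb{Z}^n)$ be such that the Minkowski sum $\sum_{i=1}^m P_i$ also belongs to $\mathcal{P}_d(\mathbb{Z}^n)$. Then the numbers $\operatorname{Vol}_d\bigl(\sum_{i=1}^m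 P_i\bigr)$ and $\operatorname{Vol}_d(P_1),\dots,\operatorname{Vol}_d(P_m)$ are non-negative integers and $$\operatorname{Vol}_d\Bigl(\sum_{i=1}^m P_i\Bigr)\equiv\sum_{i=1}^m\operatorname{Vol}_d(P_i)\pmod p.$$ -/

import Mathlib

open scoped Pointwise Nat
open MeasureTheory

namespace LatticeVolume

/-- The integer lattice `ℤⁿ` as a subset of `ℝⁿ`. -/
def intLattice (n : ℕ) : Set (Fin n → ℝ) :=
  Set.range fun (z : Fin n → ℤ) (i : Fin n) => (z i : ℝ)

/-- The family `𝒫(S)` of non-empty polytopes that are convex hulls of finitely many points of `S`;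
`𝒫(ℤⁿ)` is the family of lattice polytopes. -/
def polytopes {n : ℕ} (S : Set (Fin n → ℝ)) : Set (Set (Fin n → ℝ)) :=
  {P | ∃ V : Finset (Fin n → ℝ), V.Nonempty ∧ (V : Set (Fin n → ℝ)) ⊆ S ∧
    P = convexHull ℝ (V : Set (Fin n → ℝ))}

/-- The dimension of a set: the dimension of its affine hull. -/
noncomputable def dim {n : ℕ} (P : Set (Fin n → ℝ)) : ℕ :=
  Module.finrank ℝ (affineSpan ℝ P).direction

/-- The family `𝒫_d(S)` of members of `𝒫(S)` of dimension at most `d`. -/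
def polytopesOfDimLE {n : ℕ} (d : ℕ) (S : Set (Fin n → ℝ)) : Set (Set (Fin n → ℝ)) :=
  {P | P ∈ polytopes S ∧ dim P ≤ d}

/-- `T : ℝᵈ → ℝⁿ` is an affine bijection onto the affine hull `Y` of `P` with
`T(ℤᵈ) = Y ∩ ℤⁿ`. -/
structure IsLatticeParam {n d : ℕ} (P : Set (Fin n → ℝ))
    (T : (Fin d → ℝ) →ᵃ[ℝ] (Fin n → ℝ)) : Prop where
  injective : Function.Injective T
  range_eq : Set.range T = (affineSpan ℝ P : Set (Fin n → ℝ))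
  image_lattice : T '' intLattice d = (affineSpan ℝ P : Set (Fin n → ℝ)) ∩ intLattice n

open Classical in
/-- The normalized `d`-dimensional volume `Vol_d(P)` of `P ∈ 𝒫_d(ℤⁿ)`: it is `0` if `dim P < d`,
and `d! · vol_d(T⁻¹(P))` for a lattice-preserving affine parametrization `T : ℝᵈ → aff P` if
`dim P = d`. (Such a `T` exists for every `d`-dimensional lattice polytope; the value does not
depend on it, see `normalizedVolume_eq`.) -/
noncomputable def normalizedVolume {n : ℕ} (d : ℕ) (P : Set (Fin n → ℝ)) : ℝ :=
  if h : dim P = d ∧ ∃ T : (Fin d → ℝ) →ᵃ[ℝ] (Fin n → ℝ), IsLatticeParam P T then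
    (d ! : ℝ) * volume.real (h.2.choose ⁻¹' P)
  else 0

theorem IsLatticeParam.exists_transition {n d : ℕ} {P : Set (Fin n → ℝ)}
    {T T' : (Fin d → ℝ) →ᵃ[ℝ] (Fin n → ℝ)} (hT : IsLatticeParam P T) (hT' : IsLatticeParam P T') :
    ∃ (L : (Fin d → ℝ) →ₗ[ℝ] (Fin d → ℝ)) (y : Fin d → ℝ), (∀ x, T' (L x + y) = T x) ∧
      (∀ x, T'.linear (L x) = T.linear x) ∧ ∃ k : ℤ, LinearMap.det L = k := by
  have hinj' : Function.Injective T'.linear := T'.linear_injective_iff.2 hT'.injective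
  have hex : ∀ x, ∃ y, T' y = T x := fun x => by
    have : T x ∈ Set.range T' := by rw [hT'.range_eq, ← hT.range_eq]; exact ⟨x, rfl⟩
    exact this
  obtain ⟨y, hy⟩ := hex 0
  have hlin : ∀ x, T.linear x ∈ LinearMap.range T'.linear := fun x => by
    obtain ⟨z, hz⟩ := hex x
    refine ⟨z - y, ?_⟩
    have h1 := T'.linearMap_vsub z y
    have h2 := T.linearMap_vsub x 0
    simp only [vsub_eq_sub, sub_zero] at h1 h2
    rw [h1, h2, hz, hy]
  let L : (Fin d → ℝ) →ₗ[ℝ] (Fin d → ℝ) :=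
    (LinearEquiv.ofInjective T'.linear hinj').symm.toLinearMap ∘ₗ
      T.linear.codRestrict (LinearMap.range T'.linear) hlin
  have hL : ∀ x, T'.linear (L x) = T.linear x := fun x => by
    have := LinearEquiv.apply_symm_apply (LinearEquiv.ofInjective T'.linear hinj')
      (T.linear.codRestrict (LinearMap.range T'.linear) hlin x)
    exact congrArg Subtype.val this
  have hTL : ∀ x, T' (L x + y) = T x := fun x => by
    have h1 := T'.map_vadd y (L x)
    have h2 := T.map_vadd 0 x
    simp only [vadd_eq_add, add_zero] at h1 h2
    rw [h1, h2, hL, hy]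
  have hlat : ∀ x ∈ intLattice d, L x + y ∈ intLattice d := fun x hx => by
    have : T x ∈ T' '' intLattice d := by
      rw [hT'.image_lattice, ← hT.image_lattice]; exact ⟨x, hx, rfl⟩
    obtain ⟨w, hw, hwx⟩ := this
    rwa [← hT'.injective (hwx.trans (hTL x).symm)]
  have hy0 : y ∈ intLattice d := by
    have := hlat 0 ⟨0, by ext; simp⟩
    simpa using this
  have hentry : ∀ i j, ∃ k : ℤ, LinearMap.toMatrix' L i j = k := fun i j => by
    obtain ⟨a, ha⟩ := hlat (Pi.single j 1) ⟨Pi.single j 1, by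
      ext i; by_cases h : i = j
      · subst h; simp
      · simp [h]⟩
    obtain ⟨b, hb⟩ := hy0
    refine ⟨a i - b i, ?_⟩
    have h1 := congrFun ha i
    have h2 := congrFun hb i
    simp only [Pi.add_apply] at h1 h2
    rw [LinearMap.toMatrix'_apply]
    push_cast
    rw [h1, h2]
    simp
  choose M hM using hentry
  refine ⟨L, y, hTL, hL, (Matrix.of M).det, ?_⟩
  rw [← LinearMap.det_toMatrix']
  have : LinearMap.toMatrix' L = (Int.castRingHom ℝ).mapMatrix (Matrix.of M) := by
    ext i j; simp [hM]
  rw [this, ← RingHom.map_det]; simp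

/-- The volume of `T⁻¹(P)` does not depend on the choice of `T`. -/
theorem IsLatticeParam.volume_eq {n d : ℕ} {P : Set (Fin n → ℝ)}
    {T T' : (Fin d → ℝ) →ᵃ[ℝ] (Fin n → ℝ)} (hT : IsLatticeParam P T) (hT' : IsLatticeParam P T') :
    volume (T ⁻¹' P) = volume (T' ⁻¹' P) := by
  obtain ⟨L, y, hTL, hL, k, hk⟩ := hT.exists_transition hT'
  obtain ⟨L', y', -, hL', k', hk'⟩ := hT'.exists_transition hT
  have hid : L' ∘ₗ L = LinearMap.id := LinearMap.ext fun x =>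
    T.linear_injective_iff.2 hT.injective (by simp [hL, hL'])
  have hkk : k' * k = 1 := by
    have := congrArg LinearMap.det hid
    rw [LinearMap.det_comp, hk, hk', LinearMap.det_id] at this
    exact_mod_cast this
  have habs : |(k : ℝ)| = 1 := by
    rcases Int.isUnit_iff.1 (IsUnit.of_mul_eq_one_right k' hkk) with h | h <;> simp [h]
  have hdet : LinearMap.det L ≠ 0 := by
    rw [hk]; intro h; rw [h] at habs; simp at habs
  have hpre : T ⁻¹' P = L ⁻¹' ((fun x => x + y) ⁻¹' (T' ⁻¹' P)) := by
    ext x; simp [hTL]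
  rw [hpre, Measure.addHaar_preimage_linearMap _ hdet, measure_preimage_add_right, hk,
    abs_inv, habs]
  simp

/-- `Vol_d(P)` may be computed from any admissible parametrization of the affine hull. -/
theorem normalizedVolume_eq {n d : ℕ} {P : Set (Fin n → ℝ)} (hP : dim P = d)
    {T : (Fin d → ℝ) →ᵃ[ℝ] (Fin n → ℝ)} (hT : IsLatticeParam P T) :
    normalizedVolume d P = (d ! : ℝ) * volume.real (T ⁻¹' P) := by
  have h : dim P = d ∧ ∃ T : (Fin d → ℝ) →ᵃ[ℝ] (Fin n → ℝ), IsLatticeParam P T := ⟨hP, T, hT⟩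
  rw [normalizedVolume, dif_pos h, Measure.real, Measure.real, h.2.choose_spec.volume_eq hT]

end LatticeVolume

/-! For lattice polytopes `A`, `B` in `ℝᵈ`, the number of lattice points of `xA + yB` agrees for
large `x`, `y` with an integer-valued polynomial. Such a polynomial is an integral combination of
products `x.choose a * y.choose b`. Comparing its terms of degree `d` with the volume asymptotics
along `(Nk, Nl)` gives `d! · vol(kA + lB) = ∑ c a * d.choose a * k ^ a * l ^ (d - a)` with integers
`c a`, where `c d` and `c 0` are the normalized volumes of `A` and `B` (`exists_mixedVolume`). For
`d = p ^ t` every inner binomial coefficient is divisible by `p`, so normalized volume is additive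
mod `p`; induction handles `m` summands.

Polynomiality (`ncard_latticePoints_mem`) is a bigraded Hilbert function argument. The lattice
points form a finitely generated module over a free commutative monoid (Gordan). Lexicographically
least representations reduce the count to complements of upper sets in `ℕᵏ`, treated by induction on
`k`.

In `ℝⁿ`, if the Minkowski sum has dimension below `d`, all the volumes vanish. Otherwise each
summand is a lattice translate of the image of a lattice polytope in `ℝᵈ` under one common
lattice-preserving linear map. -/

namespace LatticeVolume

/-! ### Eventually polynomial functions -/

/-- Integer sequences that are eventually annihilated by an iterated difference operator, that is,
integer sequences that eventually agree with a polynomial. -/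
def eventuallyPoly : Submodule ℤ (ℕ → ℤ) where
  carrier := {u | ∃ D N, ∀ n, N ≤ n → (fwdDiff 1)^[D] u n = 0}
  zero_mem' := ⟨0, 0, fun _ _ => rfl⟩
  add_mem' := by
    have key : ∀ (u : ℕ → ℤ) (D N k : ℕ), (∀ n, N ≤ n → (fwdDiff 1)^[D] u n = 0) →
        ∀ n, N ≤ n → (fwdDiff 1)^[D + k] u n = 0 := by
      intro u D N k h
      induction k with
      | zero => exact h
      | succ k ih =>
        intro n hn
        rw [← add_assoc, Function.iterate_succ_apply', fwdDiff, ih n hn, ih (n + 1) (by omega),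
          sub_zero]
    rintro u v ⟨D, N, h⟩ ⟨D', N', h'⟩
    refine ⟨D + D', max N N', fun n hn => ?_⟩
    rw [fwdDiff_iter_add, Pi.add_apply, key u D N D' h n (le_trans (le_max_left _ _) hn),
      add_comm D, key v D' N' D h' n (le_trans (le_max_right _ _) hn), add_zero]
  smul_mem' := by
    rintro c u ⟨D, N, h⟩
    refine ⟨D, N, fun n hn => ?_⟩
    rw [fwdDiff_iter_const_smul, Pi.smul_apply, h n hn, smul_zero]

theorem eventuallyPoly_of_eventually_zero {u : ℕ → ℤ} (N : ℕ) (h : ∀ n, N ≤ n → u n = 0) :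
    u ∈ eventuallyPoly :=
  ⟨0, N, h⟩

/-- Newton's forward difference formula at base point `M`: the coefficients are iterated differences
of an integer sequence, which is the source of all integrality below. Any large base point and
length are allowed so that several expansions can share them. -/
theorem exists_choose_expansion {u : ℕ → ℤ} (hu : u ∈ eventuallyPoly) :
    ∃ N, ∀ M, N ≤ M → ∃ D, ∀ D', D ≤ D' → ∃ c : ℕ → ℤ, ∀ n,
      u (M + n) = ∑ a ∈ Finset.range D', (n.choose a : ℤ) * c a := by
  obtain ⟨D, N, h⟩ := hu
  refine ⟨N, fun M hM => ⟨D, fun D' hD => ⟨fun a => (fwdDiff 1)^[a] u M, fun n => ?_⟩⟩⟩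
  have hz : ∀ a, D ≤ a → ∀ n, M ≤ n → (fwdDiff 1)^[a] u n = 0 := by
    intro a ha
    induction a, ha using Nat.le_induction with
    | base => exact fun n hn => h n (hM.trans hn)
    | succ a _ ih =>
      intro n hn
      rw [Function.iterate_succ_apply', fwdDiff, ih n hn, ih (n + 1) (by omega), sub_zero]
  have := shift_eq_sum_fwdDiff_iter (1 : ℕ) u n M
  simp only [smul_eq_mul, mul_one, nsmul_eq_mul] at this
  rw [this]
  have e1 : ∑ a ∈ Finset.range (n + 1), (n.choose a : ℤ) * (fwdDiff 1)^[a] u M =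
      ∑ a ∈ Finset.range (max (n + 1) D'), (n.choose a : ℤ) * (fwdDiff 1)^[a] u M := by
    refine Finset.sum_subset (Finset.range_mono (le_max_left _ _)) fun a _ ha => ?_
    rw [Nat.choose_eq_zero_of_lt (by simpa [Nat.lt_succ_iff] using ha)]; simp
  rw [e1]
  symm
  refine Finset.sum_subset (Finset.range_mono (le_max_right _ _)) fun a _ ha => ?_
  simp only [hz a (hD.trans (by simpa using ha)) M le_rfl, mul_zero]

/-- Translation of a sequence by `j`, filled up with zeros. -/
def shiftRight (j : ℕ) : (ℕ → ℤ) →ₗ[ℤ] (ℕ → ℤ) where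
  toFun u x := if j ≤ x then u (x - j) else 0
  map_add' u v := by ext x; by_cases h : j ≤ x <;> simp [h]
  map_smul' c u := by ext x; by_cases h : j ≤ x <;> simp [h]

/-- Partial sums of a sequence. -/
def partialSum : (ℕ → ℤ) →ₗ[ℤ] (ℕ → ℤ) where
  toFun u x := ∑ j ∈ Finset.range (x + 1), u (x - j)
  map_add' u v := by ext x; simp [Finset.sum_add_distrib]
  map_smul' c u := by ext x; simp [Finset.mul_sum]

theorem shiftRight_mem (j : ℕ) {u : ℕ → ℤ} (hu : u ∈ eventuallyPoly) :
    shiftRight j u ∈ eventuallyPoly := by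
  obtain ⟨D, N, h⟩ := hu
  refine ⟨D, N + j, fun n hn => ?_⟩
  have h1 := fwdDiff_iter_comp_add (1 : ℕ) (shiftRight j u) j D (n - j)
  have h2 : (fun r => shiftRight j u (r + j)) = u := by ext r; simp [shiftRight]
  rw [h2, h _ (by omega), Nat.sub_add_cancel (by omega)] at h1
  exact h1.symm

theorem partialSum_mem {u : ℕ → ℤ} (hu : u ∈ eventuallyPoly) :
    partialSum u ∈ eventuallyPoly := by
  obtain ⟨D, N, h⟩ := hu
  refine ⟨D + 1, N, fun n hn => ?_⟩
  -- Differencing undoes summation up to a shift, so one more difference annihilates the partial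
  -- sums.
  have h2 : fwdDiff 1 (partialSum u) = fun r => u (r + 1) := by
    ext r
    have hr : ∀ x, partialSum u x = ∑ j ∈ Finset.range (x + 1), u j := fun x =>
      (Finset.sum_range_reflect u (x + 1)) ▸ Finset.sum_congr rfl fun j _ => by simp
    rw [fwdDiff, hr, hr, Finset.sum_range_succ _ (r + 1)]; ring
  rw [Function.iterate_succ_apply, h2, fwdDiff_iter_comp_add]
  exact h _ (by omega)

/-- Functions of two variables that are sums of products of eventually polynomial sequences. -/
def eventuallyPoly₂ : Submodule ℤ (ℕ → ℕ → ℤ) :=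
  Submodule.span ℤ {F | ∃ u ∈ eventuallyPoly, ∃ v ∈ eventuallyPoly, F = fun x y => u x * v y}

/-- Apply an operator on sequences to the first variable. -/
def onFst (T : (ℕ → ℤ) →ₗ[ℤ] (ℕ → ℤ)) : (ℕ → ℕ → ℤ) →ₗ[ℤ] (ℕ → ℕ → ℤ) where
  toFun F x y := T (fun x₁ => F x₁ y) x
  map_add' F G := by ext x y; exact congrFun (T.map_add (fun x₁ => F x₁ y) fun x₁ => G x₁ y) x
  map_smul' c F := by ext x y; exact congrFun (T.map_smul c (fun x₁ => F x₁ y)) x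

/-- Apply an operator on sequences to the second variable. -/
def onSnd (T : (ℕ → ℤ) →ₗ[ℤ] (ℕ → ℤ)) : (ℕ → ℕ → ℤ) →ₗ[ℤ] (ℕ → ℕ → ℤ) where
  toFun F x := T (F x)
  map_add' F G := by ext x y; simp
  map_smul' c F := by ext x y; exact congrFun (T.map_smul c (F x)) y

theorem onFst_mem {T : (ℕ → ℤ) →ₗ[ℤ] (ℕ → ℤ)}
    (hT : ∀ u ∈ eventuallyPoly, T u ∈ eventuallyPoly) {F : ℕ → ℕ → ℤ}
    (hF : F ∈ eventuallyPoly₂) : onFst T F ∈ eventuallyPoly₂ := by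
  refine (Submodule.span_le (p := eventuallyPoly₂.comap (onFst T))).2 ?_ hF
  rintro _ ⟨u, hu, v, hv, rfl⟩
  refine Submodule.subset_span ⟨T u, hT u hu, v, hv, ?_⟩
  ext x y
  have := congrFun (T.map_smul (v y) u) x
  simp only [Pi.smul_apply, smul_eq_mul] at this
  have hu' : (fun x₁ => u x₁ * v y) = v y • u := funext fun x₁ => mul_comm _ _
  rw [mul_comm, ← this, ← hu']
  rfl

theorem onSnd_mem {T : (ℕ → ℤ) →ₗ[ℤ] (ℕ → ℤ)}
    (hT : ∀ u ∈ eventuallyPoly, T u ∈ eventuallyPoly) {F : ℕ → ℕ → ℤ}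
    (hF : F ∈ eventuallyPoly₂) : onSnd T F ∈ eventuallyPoly₂ := by
  refine (Submodule.span_le (p := eventuallyPoly₂.comap (onSnd T))).2 ?_ hF
  rintro _ ⟨u, hu, v, hv, rfl⟩
  refine Submodule.subset_span ⟨u, hu, T v, hT v hv, ?_⟩
  ext x y
  exact congrFun (T.map_smul (u x) v) y

theorem exists_choose_expansion₂ {F : ℕ → ℕ → ℤ} (hF : F ∈ eventuallyPoly₂) :
    ∃ N, ∀ M, N ≤ M → ∃ D, ∀ D', D ≤ D' → ∃ c : ℕ → ℕ → ℤ, ∀ x y, F (M + x) (M + y) =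
      ∑ a ∈ Finset.range D', ∑ b ∈ Finset.range D', c a b * (x.choose a * y.choose b) := by
  induction hF using Submodule.span_induction with
  | mem F h =>
    obtain ⟨u, hu, v, hv, rfl⟩ := h
    obtain ⟨N, h⟩ := exists_choose_expansion hu
    obtain ⟨N', h'⟩ := exists_choose_expansion hv
    refine ⟨max N N', fun M hM => ?_⟩
    obtain ⟨D, h⟩ := h M (le_trans (le_max_left _ _) hM)
    obtain ⟨D', h'⟩ := h' M (le_trans (le_max_right _ _) hM)
    refine ⟨max D D', fun K hK => ?_⟩
    obtain ⟨c, h⟩ := h K (le_trans (le_max_left _ _) hK)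
    obtain ⟨c', h'⟩ := h' K (le_trans (le_max_right _ _) hK)
    refine ⟨fun a b => c a * c' b, fun x y => ?_⟩
    simp only [h, h', Finset.sum_mul_sum]
    exact Finset.sum_congr rfl fun a _ => Finset.sum_congr rfl fun b _ => by ring
  | zero => exact ⟨0, fun M _ => ⟨0, fun D _ => ⟨0, fun x y => by simp⟩⟩⟩
  | add F G _ _ hF hG =>
    obtain ⟨N, h⟩ := hF
    obtain ⟨N', h'⟩ := hG
    refine ⟨max N N', fun M hM => ?_⟩
    obtain ⟨D, h⟩ := h M (le_trans (le_max_left _ _) hM)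
    obtain ⟨D', h'⟩ := h' M (le_trans (le_max_right _ _) hM)
    refine ⟨max D D', fun K hK => ?_⟩
    obtain ⟨c, h⟩ := h K (le_trans (le_max_left _ _) hK)
    obtain ⟨c', h'⟩ := h' K (le_trans (le_max_right _ _) hK)
    refine ⟨fun a b => c a b + c' a b, fun x y => ?_⟩
    simp only [Pi.add_apply, h, h', ← Finset.sum_add_distrib, add_mul]
  | smul r F _ hF =>
    obtain ⟨N, h⟩ := hF
    refine ⟨N, fun M hM => ?_⟩
    obtain ⟨D, h⟩ := h M hM
    refine ⟨D, fun K hK => ?_⟩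
    obtain ⟨c, h⟩ := h K hK
    refine ⟨fun a b => r * c a b, fun x y => ?_⟩
    simp only [Pi.smul_apply, h, smul_eq_mul, Finset.mul_sum, mul_assoc]

/-! ### Hilbert functions of complements of upper sets -/

/-- The sum of those entries of `a` whose index has colour `c`. -/
def tally {k : ℕ} (col : Fin k → Bool) (c : Bool) (a : Fin k → ℕ) : ℕ :=
  ∑ i, if col i = c then a i else 0

theorem tally_cons {k : ℕ} (col : Fin (k + 1) → Bool) (c : Bool) (j : ℕ) (a : Fin k → ℕ) :
    tally col c (Fin.cons j a) = (if col 0 = c then j else 0) + tally (Fin.tail col) c a := by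
  simp only [tally, Fin.sum_univ_succ, Fin.tail, Fin.cons_zero, Fin.cons_succ]
  rfl

theorem finite_tally {k : ℕ} (col : Fin k → Bool) (x y : ℕ) :
    {a | tally col false a = x ∧ tally col true a = y}.Finite := by
  refine (Set.finite_Iic (fun _ : Fin k => x + y)).subset ?_
  rintro a ⟨h1, h2⟩ i
  have h : ∀ c, col i = c → a i ≤ tally col c a := fun c hc => by
    have := Finset.single_le_sum (f := fun i => if col i = c then a i else 0)
      (fun _ _ => Nat.zero_le _) (Finset.mem_univ i)
    rw [if_pos hc] at this
    exact this
  show a i ≤ x + y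
  cases hc : col i
  · have := h _ hc; omega
  · have := h _ hc; omega

/-- The number of vectors of given bidegree outside of `U`. -/
noncomputable def hilbertFun {k : ℕ} (col : Fin k → Bool) (U : Set (Fin k → ℕ)) (x y : ℕ) : ℤ :=
  ({a | a ∉ U ∧ tally col false a = x ∧ tally col true a = y}.ncard : ℤ)

theorem finite_hilbert {k : ℕ} (col : Fin k → Bool) (U : Set (Fin k → ℕ)) (x y : ℕ) :
    {a | a ∉ U ∧ tally col false a = x ∧ tally col true a = y}.Finite :=
  (finite_tally col x y).subset fun _ h => h.2

/-- Slices of an upper set of `ℕᵏ⁺¹` stabilize. -/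
theorem exists_slice_stable {k : ℕ} {U : Set (Fin (k + 1) → ℕ)} (hU : IsUpperSet U) :
    ∃ J, ∀ j, J ≤ j → ∀ b : Fin k → ℕ, (Fin.cons j b : Fin (k + 1) → ℕ) ∈ U ↔
      (Fin.cons J b : Fin (k + 1) → ℕ) ∈ U := by
  -- Dickson's lemma: `U` has finitely many minimal elements. Beyond their largest first coordinate
  -- `J`, the first coordinate no longer affects membership.
  have hfin : {a | Minimal (· ∈ U) a}.Finite :=
    WellQuasiOrderedLE.finite_of_isAntichain (setOfPred_minimal_antichain _)
  obtain ⟨J, hJ⟩ := (hfin.image fun a => a 0).bddAbove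
  refine ⟨J, fun j hj b => ⟨fun h => ?_, fun h => hU (Fin.cons_le_cons.2 ⟨hj, le_rfl⟩) h⟩⟩
  obtain ⟨a, ha, hmin⟩ := exists_minimal_le_of_wellFoundedLT (· ∈ U) _ h
  refine hU ?_ hmin.prop
  rw [← Fin.cons_self_tail a] at ha ⊢
  exact Fin.cons_le_cons.2 ⟨hJ ⟨a, hmin, rfl⟩, (Fin.cons_le_cons.1 ha).2⟩

/-- Counting is done by the value `j` of the first coordinate; `f j` and `g j` are the degrees left
for the other coordinates. The bound `j < n` keeps these truncated differences meaningful, and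
leaving `f`, `g` free covers both colours of the first index. -/
theorem hilbertFun_eq_sum_slices {k : ℕ} (col : Fin (k + 1) → Bool) (U : Set (Fin (k + 1) → ℕ))
    (x y n : ℕ) (f g : ℕ → ℕ)
    (hn : ∀ j b, tally col false (Fin.cons j b) = x ∧ tally col true (Fin.cons j b) = y ↔
      j < n ∧ tally (Fin.tail col) false b = f j ∧ tally (Fin.tail col) true b = g j) :
    hilbertFun col U x y = ∑ j ∈ Finset.range n,
      hilbertFun (Fin.tail col) {b | (Fin.cons j b : Fin (k + 1) → ℕ) ∈ U} (f j) (g j) := by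
  classical
  have hfin := finite_hilbert col U x y
  rw [hilbertFun, Set.ncard_eq_toFinset_card _ hfin,
    Finset.card_eq_sum_card_fiberwise (f := fun a => a 0) (t := Finset.range n)]
  · rw [Nat.cast_sum]
    refine Finset.sum_congr rfl fun j hj => ?_
    rw [hilbertFun, ← Set.ncard_image_of_injective _ (Fin.cons_right_injective (α := fun _ => ℕ) j),
      ← Set.ncard_coe_finset]
    congr 2
    ext a
    simp only [Finset.coe_filter, Set.Finite.mem_toFinset, Set.mem_ofPred_eq, Set.mem_image]
    constructor
    · rintro ⟨⟨h1, h2⟩, rfl⟩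
      rw [← Fin.cons_self_tail a] at h1 h2
      exact ⟨Fin.tail a, ⟨h1, ((hn _ _).1 h2).2⟩, Fin.cons_self_tail a⟩
    · rintro ⟨b, ⟨h1, h2⟩, rfl⟩
      exact ⟨⟨h1, (hn _ _).2 ⟨Finset.mem_range.1 hj, h2⟩⟩, rfl⟩
  · intro a ha
    have h2 := ((Set.Finite.mem_toFinset hfin).1 ha).2
    rw [← Fin.cons_self_tail a] at h2
    exact Finset.mem_coe.2 (Finset.mem_range.2 ((hn _ _).1 h2).1)

/-- Replacing every slice by the stable one costs only finitely many correction terms. The sum thus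
becomes finitely many shifts plus one partial sum, operations that preserve eventual polynomiality.
-/
theorem sum_range_eq_of_stable (h : ℕ → ℕ → ℤ) (J : ℕ) (hJ : ∀ j, J ≤ j → h j = h J) (x : ℕ) :
    ∑ j ∈ Finset.range (x + 1), h j (x - j) =
      (∑ j ∈ Finset.range J, if j ≤ x then h j (x - j) - h J (x - j) else 0) +
        ∑ j ∈ Finset.range (x + 1), h J (x - j) := by
  rw [← sub_eq_iff_eq_add, ← Finset.sum_sub_distrib, ← Finset.sum_filter]
  refine (Finset.sum_subset (fun j => ?_) fun j h1 h2 => ?_).symm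
  · simp only [Finset.mem_filter, Finset.mem_range]; omega
  · simp only [Finset.mem_filter, Finset.mem_range] at h1 h2
    rw [hJ j (by omega), sub_self]

/-- A combinatorial Hilbert–Serre theorem, by induction on the number of variables: slices of an
upper set are upper sets and eventually constant. -/
theorem hilbertFun_mem {k : ℕ} (col : Fin k → Bool) (U : Set (Fin k → ℕ)) (hU : IsUpperSet U) :
    hilbertFun col U ∈ eventuallyPoly₂ := by
  induction k with
  | zero =>
    by_cases h0 : ∀ a, a ∈ U
    · convert Submodule.zero_mem eventuallyPoly₂
      ext x y
      have : {a | a ∉ U ∧ tally col false a = x ∧ tally col true a = y} = ∅ := by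
        ext a; simp [h0 a]
      simp [hilbertFun, this]
    · replace h0 : ∀ a, a ∉ U := fun a ha => h0 fun b => Subsingleton.elim a b ▸ ha
      have hE : (fun x => if x = 0 then (1 : ℤ) else 0) ∈ eventuallyPoly :=
        eventuallyPoly_of_eventually_zero 1 fun n hn => if_neg (by omega)
      refine Submodule.subset_span ⟨_, hE, _, hE, ?_⟩
      ext x y
      have : {a | a ∉ U ∧ tally col false a = x ∧ tally col true a = y} =
          {_a | x = 0 ∧ y = 0} := by
        ext a; simp [h0 a, tally, @eq_comm ℕ 0]
      rw [hilbertFun, this]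
      by_cases hx : x = 0 <;> by_cases hy : y = 0 <;> simp [hx, hy]
  | succ k ih =>
    obtain ⟨J, hJ⟩ := exists_slice_stable hU
    have hslice : ∀ j, hilbertFun (Fin.tail col) {b | (Fin.cons j b : Fin (k + 1) → ℕ) ∈ U} ∈
        eventuallyPoly₂ := fun j =>
      ih _ _ fun b b' hb h => hU (Fin.cons_le_cons.2 ⟨le_rfl, hb⟩) h
    have hstab : ∀ j, J ≤ j → {b | (Fin.cons j b : Fin (k + 1) → ℕ) ∈ U} =
        {b | (Fin.cons J b : Fin (k + 1) → ℕ) ∈ U} := fun j hj => Set.ext fun b => hJ j hj b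
    set h : ℕ → ℕ → ℕ → ℤ := fun j =>
      hilbertFun (Fin.tail col) {b | (Fin.cons j b : Fin (k + 1) → ℕ) ∈ U} with hh
    have hhJ : ∀ j, J ≤ j → h j = h J := fun j hj => by simp only [hh, hstab j hj]
    cases hc : col 0
    · have key : hilbertFun col U =
          ∑ j ∈ Finset.range J, onFst (shiftRight j) (h j - h J) + onFst partialSum (h J) := by
        ext x y
        rw [hilbertFun_eq_sum_slices col U x y (x + 1) (fun j => x - j) (fun _ => y) fun j b => by
          simp only [tally_cons, hc]; simp; omega]
        simp only [Pi.add_apply, Finset.sum_apply]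
        exact sum_range_eq_of_stable (fun j x => h j x y) J
          (fun j hj => funext fun x => by rw [hhJ j hj]) x
      rw [key]
      exact add_mem (sum_mem fun j _ => onFst_mem (fun u => shiftRight_mem j)
        (sub_mem (hslice j) (hslice J))) (onFst_mem (fun u => partialSum_mem) (hslice J))
    · have key : hilbertFun col U =
          ∑ j ∈ Finset.range J, onSnd (shiftRight j) (h j - h J) + onSnd partialSum (h J) := by
        ext x y
        rw [hilbertFun_eq_sum_slices col U x y (y + 1) (fun _ => x) (fun j => y - j) fun j b => by
          simp only [tally_cons, hc]; simp; omega]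
        simp only [Pi.add_apply, Finset.sum_apply]
        exact sum_range_eq_of_stable (fun j y => h j x y) J
          (fun j hj => funext fun y => by rw [hhJ j hj]) y
      rw [key]
      exact add_mem (sum_mem fun j _ => onSnd_mem (fun u => shiftRight_mem j)
        (sub_mem (hslice j) (hslice J))) (onSnd_mem (fun u => partialSum_mem) (hslice J))

/-! ### Counting elements of finitely generated modules over a free commutative monoid -/

section Count

variable {M : Type*} [AddCommMonoid M] {k s : ℕ}

/-- The element `r i + ∑ a j • g j`. -/
def genVal (g : Fin k → M) (r : Fin s → M) (i : Fin s) (a : Fin k → ℕ) : M :=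
  r i + ∑ j, a j • g j

theorem genVal_add (g : Fin k → M) (r : Fin s → M) (i : Fin s) (a b : Fin k → ℕ) :
    genVal g r i (a + b) = genVal g r i a + ∑ j, b j • g j := by
  simp [genVal, add_smul, Finset.sum_add_distrib, add_assoc]

/-- Exponents that are not the lexicographically smallest ones representing their value. -/
def redundant (g : Fin k → M) (r : Fin s → M) (i : Fin s) : Set (Fin k → ℕ) :=
  {a | ∃ i' a', genVal g r i' a' = genVal g r i a ∧
    toLex (i', toLex a') < toLex (i, toLex a)}

/-- A smaller representation of the same value stays smaller, and still represents the same value,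
when a common vector is added to both exponents. -/
theorem isUpperSet_redundant (g : Fin k → M) (r : Fin s → M) (i : Fin s) :
    IsUpperSet (redundant g r i) := by
  rintro a b hab ⟨i', a', h, hlt⟩
  obtain ⟨c, rfl⟩ := exists_add_of_le hab
  refine ⟨i', a' + c, by rw [genVal_add, genVal_add, h], ?_⟩
  rw [Prod.Lex.toLex_lt_toLex] at hlt ⊢
  rcases hlt with hlt | ⟨h1, h2⟩
  · exact Or.inl hlt
  · refine Or.inr ⟨h1, ?_⟩
    rw [toLex_add, toLex_add]
    exact add_lt_add_left h2 _

theorem exists_not_redundant (g : Fin k → M) (r : Fin s → M) (i : Fin s) (a : Fin k → ℕ) :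
    ∃ i' a', genVal g r i' a' = genVal g r i a ∧ a' ∉ redundant g r i' := by
  let p : Set (Fin s ×ₗ Lex (Fin k → ℕ)) :=
    {q | genVal g r (ofLex q).1 (ofLex (ofLex q).2) = genVal g r i a}
  have hp : p.Nonempty := ⟨toLex (i, toLex a), rfl⟩
  have hwf : WellFounded ((· < ·) : Fin s ×ₗ Lex (Fin k → ℕ) → _ → Prop) := wellFounded_lt
  refine ⟨_, _, hwf.min_mem p hp, ?_⟩
  rintro ⟨i', a', h, hlt⟩
  exact hwf.not_lt_min p (x := toLex (i', toLex a')) (h.trans (hwf.min_mem p hp)) hlt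

theorem not_redundant_unique {g : Fin k → M} {r : Fin s → M} {i i' : Fin s} {a a' : Fin k → ℕ}
    (h : genVal g r i a = genVal g r i' a') (ha : a ∉ redundant g r i)
    (ha' : a' ∉ redundant g r i') : i = i' ∧ a = a' := by
  have h1 : toLex (i, toLex a) = toLex (i', toLex a') :=
    le_antisymm (not_lt.1 fun hlt => ha ⟨i', a', h.symm, hlt⟩)
      (not_lt.1 fun hlt => ha' ⟨i, a, h, hlt⟩)
  simpa using h1

/-- Each element has exactly one nonredundant representation. The count is therefore a sum over `i`
of Hilbert functions of complements of upper sets, shifted by the bidegree of `r i`. -/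
theorem ncard_bidegree_mem (col : Fin k → Bool) (g : Fin k → M) (r : Fin s → M)
    (deg : M →+ ℕ × ℕ) (hg : ∀ i, deg (g i) = if col i = false then (1, 0) else (0, 1)) :
    (fun x y => (({z | (∃ i a, genVal g r i a = z) ∧ deg z = (x, y)} : Set M).ncard : ℤ)) ∈
      eventuallyPoly₂ := by
  classical
  have hdeg : ∀ i a, deg (genVal g r i a) =
      ((deg (r i)).1 + tally col false a, (deg (r i)).2 + tally col true a) := fun i a => by
    rw [genVal, map_add, map_sum]
    ext
    · simp only [map_nsmul, hg, Prod.fst_add, Prod.fst_sum, tally]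
      congr 1
      exact Finset.sum_congr rfl fun j _ => by cases col j <;> simp
    · simp only [map_nsmul, hg, Prod.snd_add, Prod.snd_sum, tally]
      congr 1
      exact Finset.sum_congr rfl fun j _ => by cases col j <;> simp
  have key : (fun x y => (({z | (∃ i a, genVal g r i a = z) ∧ deg z = (x, y)} : Set M).ncard : ℤ)) =
      ∑ i, onFst (shiftRight (deg (r i)).1) (onSnd (shiftRight (deg (r i)).2)
        (hilbertFun col (redundant g r i))) := by
    ext x y
    have hfin : ∀ i, {a | a ∉ redundant g r i ∧ deg (genVal g r i a) = (x, y)}.Finite :=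
      fun i => (finite_tally col (x - (deg (r i)).1) (y - (deg (r i)).2)).subset fun a ha => by
        have := ha.2
        rw [hdeg, Prod.mk.injEq] at this
        constructor <;> omega
    have himg : ({z | (∃ i a, genVal g r i a = z) ∧ deg z = (x, y)} : Set M) =
        ((Finset.univ.sigma fun i => (hfin i).toFinset).image fun q => genVal g r q.1 q.2) := by
      ext z
      simp only [Finset.coe_image, Set.mem_ofPred_eq, Set.mem_image, Finset.mem_coe,
        Finset.mem_sigma, Finset.mem_univ, true_and, Set.Finite.mem_toFinset]
      constructor
      · rintro ⟨⟨i, a, rfl⟩, h⟩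
        obtain ⟨i', a', h1, h2⟩ := exists_not_redundant g r i a
        exact ⟨⟨i', a'⟩, ⟨h2, h1 ▸ h⟩, h1⟩
      · rintro ⟨⟨i, a⟩, ⟨-, h⟩, rfl⟩
        exact ⟨⟨i, a, rfl⟩, h⟩
    rw [himg, Set.ncard_coe_finset, Finset.card_image_of_injOn, Finset.card_sigma, Nat.cast_sum,
      Finset.sum_apply, Finset.sum_apply]
    · refine Finset.sum_congr rfl fun i _ => ?_
      rw [← Set.ncard_eq_toFinset_card _ (hfin i)]
      show _ = if (deg (r i)).1 ≤ x then (if (deg (r i)).2 ≤ y then hilbertFun col (redundant g r i)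
        (x - (deg (r i)).1) (y - (deg (r i)).2) else 0) else 0
      simp only [hdeg, Prod.mk.injEq]
      split_ifs with h1 h2
      · rw [hilbertFun]
        congr 2
        ext a
        simp only [Set.mem_ofPred_eq]
        refine and_congr_right fun _ => ?_
        omega
      · rw [Nat.cast_eq_zero, Set.ncard_eq_zero (by simpa only [hdeg, Prod.mk.injEq] using hfin i)]
        ext a
        simp only [Set.mem_ofPred_eq, Set.mem_empty_iff_false, iff_false]
        omega
      · rw [Nat.cast_eq_zero, Set.ncard_eq_zero (by simpa only [hdeg, Prod.mk.injEq] using hfin i)]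
        ext a
        simp only [Set.mem_ofPred_eq, Set.mem_empty_iff_false, iff_false]
        omega
    · rintro ⟨i, a⟩ h1 ⟨i', a'⟩ h2 h
      simp only [Finset.coe_sigma, Set.mem_sigma_iff, Finset.mem_coe, Set.Finite.mem_toFinset,
        Set.mem_ofPred_eq] at h1 h2
      obtain ⟨rfl, rfl⟩ := not_redundant_unique h h1.2.1 h2.2.1
      rfl
  rw [key]
  exact sum_mem fun i _ => onFst_mem (fun _ => shiftRight_mem _) (onSnd_mem
    (fun _ => shiftRight_mem _) (hilbertFun_mem col _ (isUpperSet_redundant g r i)))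

end Count

/-! ### Lattice points in `x A + y B` -/

/-- The inclusion `ℤᵈ → ℝᵈ`. -/
def intEmb (d : ℕ) : (Fin d → ℤ) →+ (Fin d → ℝ) := (Int.castAddHom ℝ).compLeft (Fin d)

theorem intEmb_apply {d : ℕ} (z : Fin d → ℤ) (i : Fin d) : intEmb d z i = z i := rfl

theorem intEmb_injective (d : ℕ) : Function.Injective (intEmb d) := fun _ _ h =>
  funext fun i => Int.cast_injective (congrFun h i)

theorem range_intEmb (d : ℕ) : Set.range (intEmb d) = intLattice d := rfl

/-- The inclusion `ℤᵈ × ℕ × ℕ → ℝᵈ × ℝ × ℝ`. -/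
def gradedEmb (d : ℕ) : (Fin d → ℤ) × ℕ × ℕ →+ (Fin d → ℝ) × ℝ × ℝ :=
  (intEmb d).prodMap ((Nat.castAddMonoidHom ℝ).prodMap (Nat.castAddMonoidHom ℝ))

theorem gradedEmb_apply {d : ℕ} (z : Fin d → ℤ) (x y : ℕ) :
    gradedEmb d (z, x, y) = (intEmb d z, (x : ℝ), (y : ℝ)) := rfl

theorem finite_gradedEmb_bounded (d : ℕ) (C : ℝ) : {m | ‖gradedEmb d m‖ ≤ C}.Finite := by
  obtain ⟨K, hK⟩ := exists_nat_ge C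
  refine ((Set.finite_Icc (fun _ : Fin d => -(K : ℤ)) fun _ => (K : ℤ)).prod
    ((Set.finite_Iic K).prod (Set.finite_Iic K))).subset ?_
  rintro ⟨z, x, y⟩ h
  have h := (show ‖gradedEmb d (z, x, y)‖ ≤ C from h).trans hK
  rw [gradedEmb_apply, Prod.norm_def, Prod.norm_def, max_le_iff, max_le_iff] at h
  obtain ⟨h1, h2, h3⟩ := h
  simp only [RCLike.norm_natCast, Nat.cast_le] at h2 h3
  have hz : ∀ i, |z i| ≤ K := fun i => by
    have := (norm_le_pi_norm (intEmb d z) i).trans h1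
    rw [intEmb_apply, Real.norm_eq_abs] at this
    exact_mod_cast this
  exact ⟨⟨fun i => (abs_le.1 (hz i)).1, fun i => (abs_le.1 (hz i)).2⟩, h2, h3⟩

/-- Gordan's lemma: splitting real coefficients into integer and fractional parts writes every
lattice point of the cone as an `ℕ`-combination of the `g j` plus a lattice point of the half-open
box. The latter are finite in number and serve as module generators `r`. -/
theorem ncard_cone_mem {d k : ℕ} (col : Fin k → Bool) (v : Fin k → Fin d → ℤ)
    (g : Fin k → (Fin d → ℤ) × ℕ × ℕ)
    (hg : ∀ i, g i = (v i, if col i = false then (1, 0) else (0, 1))) :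
    (fun x y => (({z | ∃ l : Fin k → ℝ, 0 ≤ l ∧ ∑ i, l i • gradedEmb d (g i) =
      gradedEmb d (z, x, y)} : Set (Fin d → ℤ)).ncard : ℤ)) ∈ eventuallyPoly₂ := by
  have hfin : {m | ∃ l : Fin k → ℝ, (∀ i, 0 ≤ l i ∧ l i < 1) ∧
      ∑ i, l i • gradedEmb d (g i) = gradedEmb d m}.Finite := by
    refine (finite_gradedEmb_bounded d (∑ i, ‖gradedEmb d (g i)‖)).subset ?_
    rintro m ⟨l, hl, h⟩
    show ‖gradedEmb d m‖ ≤ _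
    rw [← h]
    refine norm_sum_le_of_le _ fun i _ => ?_
    rw [norm_smul, Real.norm_eq_abs, abs_of_nonneg (hl i).1]
    exact mul_le_of_le_one_left (norm_nonneg _) (hl i).2.le
  obtain ⟨s, r, hr⟩ : ∃ (s : ℕ) (r : Fin s → (Fin d → ℤ) × ℕ × ℕ), Set.range r =
      {m | ∃ l : Fin k → ℝ, (∀ i, 0 ≤ l i ∧ l i < 1) ∧
        ∑ i, l i • gradedEmb d (g i) = gradedEmb d m} := by
    obtain ⟨s, ⟨e⟩⟩ := finite_iff_exists_equiv_fin.1 hfin.to_subtype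
    exact ⟨s, fun i => (e.symm i : _), by
      rw [Set.range_comp' Subtype.val e.symm, e.symm.range_eq_univ, Set.image_univ,
        Subtype.range_coe]⟩
  have key := ncard_bidegree_mem col g r (AddMonoidHom.snd _ _) fun i => by rw [hg]; rfl
  convert key using 4 with x y
  rw [← Set.ncard_image_of_injective _
    (fun z z' (h : (z, (x, y)) = (z', (x, y))) => (Prod.mk.inj h).1)]
  congr 1
  have hsum : ∀ (i : Fin s) (a : Fin k → ℕ), gradedEmb d (genVal g r i a) =
      gradedEmb d (r i) + ∑ j, (a j : ℝ) • gradedEmb d (g j) := fun i a => by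
    simp only [genVal, map_add, map_sum, map_nsmul, Nat.cast_smul_eq_nsmul]
  ext m
  constructor
  · rintro ⟨z, ⟨l, hl, h⟩, rfl⟩
    refine ⟨?_, rfl⟩
    -- The two degrees live in `ℕ`, so subtracting the integer parts needs the inequalities `hx` and
    -- `hy`; they hold since floors only lower the nonnegative coefficients.
    have hlift : ∃ m₀ : (Fin d → ℤ) × ℕ × ℕ, (z, x, y) = m₀ + ∑ j, ⌊l j⌋₊ • g j := by
      have h' := congrArg Prod.snd h
      have hle : ∀ j, (⌊l j⌋₊ : ℝ) ≤ l j := fun j => Nat.floor_le (hl j)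
      have hx : (∑ j, ⌊l j⌋₊ • g j).2.1 ≤ x := by
        have h1 := congrArg Prod.fst h'
        simp only [gradedEmb_apply, Prod.snd_sum, Prod.fst_sum, Prod.smul_snd, Prod.smul_fst] at h1
        rw [← Nat.cast_le (α := ℝ), ← h1]
        simp only [Prod.snd_sum, Prod.fst_sum, Prod.smul_snd, Prod.smul_fst, Nat.cast_sum,
          smul_eq_mul, Nat.cast_mul]
        exact Finset.sum_le_sum fun j _ => mul_le_mul_of_nonneg_right (hle j) (Nat.cast_nonneg _)
      have hy : (∑ j, ⌊l j⌋₊ • g j).2.2 ≤ y := by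
        have h1 := congrArg Prod.snd h'
        simp only [gradedEmb_apply, Prod.snd_sum, Prod.smul_snd] at h1
        rw [← Nat.cast_le (α := ℝ), ← h1]
        simp only [Prod.snd_sum, Prod.smul_snd, Nat.cast_sum, smul_eq_mul,
          Nat.cast_mul]
        exact Finset.sum_le_sum fun j _ => mul_le_mul_of_nonneg_right (hle j) (Nat.cast_nonneg _)
      refine ⟨(z - (∑ j, ⌊l j⌋₊ • g j).1, x - (∑ j, ⌊l j⌋₊ • g j).2.1,
        y - (∑ j, ⌊l j⌋₊ • g j).2.2), ?_⟩
      ext1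
      · simp
      · ext1
        · exact (Nat.sub_add_cancel hx).symm
        · exact (Nat.sub_add_cancel hy).symm
    obtain ⟨m₀, hm₀⟩ := hlift
    have hmem : m₀ ∈ Set.range r := by
      rw [hr]
      refine ⟨fun j => l j - ⌊l j⌋₊, fun j => ⟨sub_nonneg.2 (Nat.floor_le (hl j)), ?_⟩, ?_⟩
      · have := Nat.lt_floor_add_one (l j); linarith
      · simp only [sub_smul, Finset.sum_sub_distrib]
        rw [h, hm₀, map_add, map_sum]
        simp only [map_nsmul, Nat.cast_smul_eq_nsmul, add_sub_cancel_right]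
    obtain ⟨i, rfl⟩ := hmem
    exact ⟨i, fun j => ⌊l j⌋₊, hm₀.symm⟩
  · rintro ⟨⟨i, a, rfl⟩, h⟩
    have hi : r i ∈ Set.range r := ⟨i, rfl⟩
    rw [hr] at hi
    obtain ⟨l, hl, hli⟩ := hi
    have hm : ((genVal g r i a).1, (x, y)) = genVal g r i a := Prod.ext rfl h.symm
    refine ⟨(genVal g r i a).1, ⟨fun j => l j + a j, fun j => add_nonneg (hl j).1
      (Nat.cast_nonneg _), ?_⟩, hm⟩
    rw [hm, hsum, ← hli]
    simp only [add_smul, Finset.sum_add_distrib]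

/-- Homogenization: the dilation factor becomes the total weight, making dilates slices of a cone.
For `x = 0` nonnegativity forces all weights to vanish. -/
theorem mem_smul_convexHull_iff {E : Type*} [AddCommGroup E] [Module ℝ E] {V : Finset E}
    (hV : V.Nonempty) {x : ℝ} (hx : 0 ≤ x) (z : E) :
    z ∈ x • convexHull ℝ (V : Set E) ↔
      ∃ w : V → ℝ, 0 ≤ w ∧ ∑ v, w v = x ∧ ∑ v, w v • (v : E) = z := by
  have hconv : ∀ z, z ∈ convexHull ℝ (V : Set E) ↔
      ∃ w : V → ℝ, 0 ≤ w ∧ ∑ v, w v = 1 ∧ ∑ v, w v • (v : E) = z := fun z => by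
    constructor
    · rw [Finset.mem_convexHull']
      rintro ⟨w, h0, h1, rfl⟩
      exact ⟨fun v => w v, fun v => h0 v v.2, (Finset.sum_coe_sort V w).trans h1,
        Finset.sum_coe_sort V fun v => w v • v⟩
    · rintro ⟨w, h0, h1, h⟩
      exact mem_convexHull_of_exists_fintype w (fun v => (v : E)) h0 h1 (fun v => v.2) h
  constructor
  · rintro ⟨z, hz, rfl⟩
    obtain ⟨w, h0, h1, rfl⟩ := (hconv z).1 hz
    refine ⟨x • w, smul_nonneg hx h0, ?_, ?_⟩
    · simp only [Pi.smul_apply, smul_eq_mul, ← Finset.mul_sum, h1, mul_one]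
    · simp only [Pi.smul_apply, smul_eq_mul, Finset.smul_sum, mul_smul]
  · rintro ⟨w, h0, h1, rfl⟩
    rcases hx.eq_or_lt with rfl | hx
    · have hw : ∀ i, w i = 0 := fun i =>
        (Finset.sum_eq_zero_iff_of_nonneg fun i _ => h0 i).1 h1 i (Finset.mem_univ i)
      simp only [hw, zero_smul, Finset.sum_const_zero]
      rw [Set.zero_smul_set (Set.Nonempty.convexHull hV)]
      exact Set.mem_zero.2 rfl
    · refine ⟨x⁻¹ • ∑ v, w v • (v : E), (hconv _).2 ⟨x⁻¹ • w, smul_nonneg (inv_nonneg.2 hx.le) h0,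
        ?_, ?_⟩, smul_inv_smul₀ hx.ne' _⟩
      · simp only [Pi.smul_apply, smul_eq_mul, ← Finset.mul_sum, h1, inv_mul_cancel₀ hx.ne']
      · simp only [Pi.smul_apply, smul_eq_mul, Finset.smul_sum, mul_smul]

/-- The number of lattice points of `x A + y B` is eventually a polynomial. -/
theorem ncard_latticePoints_mem {d : ℕ} {A B : Set (Fin d → ℝ)} (hA : A ∈ polytopes (intLattice d))
    (hB : B ∈ polytopes (intLattice d)) :
    (fun x y : ℕ => (({z | intEmb d z ∈ (x : ℝ) • A + (y : ℝ) • B}).ncard : ℤ)) ∈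
      eventuallyPoly₂ := by
  obtain ⟨V, hV, hVS, rfl⟩ := hA
  obtain ⟨W, hW, hWS, rfl⟩ := hB
  choose f hf using fun v : V =>
    (range_intEmb d ▸ hVS v.2 : (v : Fin d → ℝ) ∈ Set.range (intEmb d))
  choose f' hf' using fun v : W =>
    (range_intEmb d ▸ hWS v.2 : (v : Fin d → ℝ) ∈ Set.range (intEmb d))
  let e := (Fintype.equivFin (V ⊕ W)).symm
  -- Cayley trick: vertices of `A` receive degree `(1, 0)` and those of `B` degree `(0, 1)`, so the
  -- slice of the cone at `(x, y)` is `xA + yB`.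
  have key := ncard_cone_mem (fun i => (e i).isRight) (fun i => Sum.elim f f' (e i)) _ fun i => rfl
  convert key using 4 with x y
  congr 1
  have hsum : ∀ l : V ⊕ W → ℝ, ∑ i, l (e i) • gradedEmb d
      (Sum.elim f f' (e i), if (e i).isRight = false then (1, 0) else (0, 1)) =
      (∑ v, l (.inl v) • (v : Fin d → ℝ) + ∑ w, l (.inr w) • (w : Fin d → ℝ),
        ∑ v, l (.inl v), ∑ w, l (.inr w)) := fun l => by
    rw [e.sum_comp fun q => l q • gradedEmb d
      (Sum.elim f f' q, if q.isRight = false then (1, 0) else (0, 1)), Fintype.sum_sum_type]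
    simp [gradedEmb_apply, hf, hf', Prod.ext_iff, Prod.fst_sum, Prod.snd_sum]
  ext z
  simp only [Set.mem_ofPred_eq, Set.mem_add]
  constructor
  · rintro ⟨a, ha, b, hb, hab⟩
    rw [mem_smul_convexHull_iff hV (Nat.cast_nonneg x)] at ha
    rw [mem_smul_convexHull_iff hW (Nat.cast_nonneg y)] at hb
    obtain ⟨w, h0, h1, rfl⟩ := ha
    obtain ⟨w', h0', h1', rfl⟩ := hb
    refine ⟨fun i => Sum.elim w w' (e i), fun i => ?_, (hsum (Sum.elim w w')).trans ?_⟩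
    · show 0 ≤ Sum.elim w w' (e i)
      cases e i
      · exact h0 _
      · exact h0' _
    · simp only [gradedEmb_apply, ← hab, Sum.elim_inl, Sum.elim_inr, h1, h1']
  · rintro ⟨l, h0, h⟩
    have := hsum fun q => l (e.symm q)
    simp only [Equiv.symm_apply_apply] at this
    rw [this, gradedEmb_apply, Prod.mk.injEq, Prod.mk.injEq] at h
    refine ⟨_, ?_, _, ?_, h.1⟩
    · rw [mem_smul_convexHull_iff hV (Nat.cast_nonneg x)]
      exact ⟨_, fun v => h0 _, h.2.1, rfl⟩
    · rw [mem_smul_convexHull_iff hW (Nat.cast_nonneg y)]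
      exact ⟨_, fun v => h0 _, h.2.2, rfl⟩

/-! ### Leading forms -/

open Filter Topology in
theorem tendsto_choose_div_pow {k : ℕ} (hk : 1 ≤ k) (N₀ a : ℕ) :
    Tendsto (fun N : ℕ => ((N * k - N₀).choose a : ℝ) / (N : ℝ) ^ a) atTop
      (𝓝 ((k : ℝ) ^ a / a !)) := by
  have hchoose : ∀ n a : ℕ, (n.choose (a + 1) : ℝ) = n.choose a * ((n : ℝ) - a) / (a + 1) := by
    intro n a
    rw [eq_div_iff (by positivity)]
    rcases le_or_gt a n with h | h
    · rw [← Nat.cast_sub h]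
      exact_mod_cast Nat.choose_succ_right_eq n a
    · simp [Nat.choose_eq_zero_of_lt h, Nat.choose_eq_zero_of_lt (Nat.lt_succ_of_lt h)]
  induction a with
  | zero => simp
  | succ a ih =>
    have hlin : Tendsto (fun N : ℕ => (k : ℝ) - (N₀ + a) / (N : ℝ)) atTop (𝓝 (k : ℝ)) := by
      simpa using (tendsto_const_nhds (x := (k : ℝ))).sub
        ((tendsto_const_nhds (x := (N₀ + a : ℝ))).div_atTop tendsto_natCast_atTop_atTop)
    have := (ih.mul hlin).div_const ((a : ℝ) + 1)
    have hlim : (k : ℝ) ^ (a + 1) / (a + 1)! = (k : ℝ) ^ a / a ! * k / (a + 1) := by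
      rw [Nat.factorial_succ]
      have : (a ! : ℝ) ≠ 0 := by exact_mod_cast a.factorial_ne_zero
      push_cast
      rw [pow_succ]
      field_simp
    rw [hlim]
    refine this.congr' ?_
    filter_upwards [eventually_ge_atTop (N₀ + 1)] with N hN
    have hN0 : (N : ℝ) ≠ 0 := by
      have : N ≠ 0 := by omega
      exact_mod_cast this
    rw [hchoose, Nat.cast_sub (show N₀ ≤ N * k by nlinarith), Nat.cast_mul, pow_succ]
    field_simp
    ring

-- Terms of total degree below `e` vanish after division by `N ^ e`, those above have zero
-- coefficient, and only the diagonal `a + b = e` survives.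
open Filter Topology in
theorem tendsto_div_pow_of_choose_expansion {F : ℕ → ℕ → ℤ} {N₀ D : ℕ} {c : ℕ → ℕ → ℤ}
    (hF : ∀ x y, F (N₀ + x) (N₀ + y) =
      ∑ a ∈ Finset.range D, ∑ b ∈ Finset.range D, c a b * (x.choose a * y.choose b))
    {e : ℕ} (hc : ∀ a < D, ∀ b < D, e < a + b → c a b = 0) {k l : ℕ} (hk : 1 ≤ k) (hl : 1 ≤ l) :
    Tendsto (fun N : ℕ => (F (N * k) (N * l) : ℝ) / (N : ℝ) ^ e) atTop
      (𝓝 (∑ a ∈ Finset.range D, ∑ b ∈ Finset.range D, if a + b = e then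
        (c a b : ℝ) * ((k : ℝ) ^ a / a ! * ((l : ℝ) ^ b / b !)) else 0)) := by
  have hev : (fun N : ℕ => ∑ a ∈ Finset.range D, ∑ b ∈ Finset.range D, (c a b : ℝ) *
      ((((N * k - N₀).choose a : ℝ) / (N : ℝ) ^ a) * (((N * l - N₀).choose b : ℝ) / (N : ℝ) ^ b)) *
        ((N : ℝ) ^ (a + b) / (N : ℝ) ^ e)) =ᶠ[atTop]
      fun N : ℕ => (F (N * k) (N * l) : ℝ) / (N : ℝ) ^ e := by
    filter_upwards [eventually_ge_atTop (N₀ + 1)] with N hN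
    have hN0 : (N : ℝ) ≠ 0 := by
      have : N ≠ 0 := by omega
      exact_mod_cast this
    have h1 : N₀ + (N * k - N₀) = N * k := Nat.add_sub_cancel' (by nlinarith)
    have h2 : N₀ + (N * l - N₀) = N * l := Nat.add_sub_cancel' (by nlinarith)
    have := hF (N * k - N₀) (N * l - N₀)
    rw [h1, h2] at this
    rw [this]
    push_cast
    simp only [Finset.sum_div]
    refine Finset.sum_congr rfl fun a _ => Finset.sum_congr rfl fun b _ => ?_
    rw [pow_add]
    field_simp
  refine Tendsto.congr' hev (tendsto_finsetSum _ fun a ha => tendsto_finsetSum _ fun b hb => ?_)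
  rcases lt_trichotomy (a + b) e with h | h | h
  · rw [if_neg h.ne]
    have h0 : Tendsto (fun N : ℕ => (N : ℝ) ^ (a + b) / (N : ℝ) ^ e) atTop (𝓝 0) :=
      (tendsto_pow_div_pow_atTop_zero h).comp tendsto_natCast_atTop_atTop
    have := (((tendsto_choose_div_pow hk N₀ a).mul (tendsto_choose_div_pow hl N₀ b)).const_mul
      (c a b : ℝ)).mul h0
    simpa using this
  · rw [if_pos h]
    have h0 : Tendsto (fun N : ℕ => (N : ℝ) ^ (a + b) / (N : ℝ) ^ e) atTop (𝓝 1) := by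
      refine tendsto_const_nhds.congr' ?_
      filter_upwards [eventually_ge_atTop 1] with N hN
      rw [h, div_self]
      have : N ≠ 0 := by omega
      exact pow_ne_zero _ (by exact_mod_cast this)
    have := (((tendsto_choose_div_pow hk N₀ a).mul (tendsto_choose_div_pow hl N₀ b)).const_mul
      (c a b : ℝ)).mul h0
    simpa using this
  · rw [if_neg h.ne', hc a (Finset.mem_range.1 ha) b (Finset.mem_range.1 hb) h]
    simp

theorem sum_sum_ite_add_eq {D d : ℕ} (hD : d < D) (g : ℕ → ℕ → ℝ) :
    (∑ a ∈ Finset.range D, ∑ b ∈ Finset.range D, if a + b = d then g a b else 0) =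
      ∑ a ∈ Finset.range (d + 1), g a (d - a) := by
  symm
  rw [← Finset.sum_subset (Finset.range_mono hD : Finset.range (d + 1) ⊆ _)]
  · refine Finset.sum_congr rfl fun a ha => ?_
    rw [Finset.mem_range] at ha
    rw [Finset.sum_eq_single (d - a), if_pos (by omega)]
    · exact fun b _ hb => if_neg (by omega)
    · intro h; rw [Finset.mem_range] at h; omega
  · intro a _ ha
    rw [Finset.mem_range] at ha
    exact Finset.sum_eq_zero fun b _ => if_neg (by omega)

-- Otherwise let `a₀ + b₀ > d` be the largest total degree of a nonzero coefficient. Growth of order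
-- `N ^ d` makes that top form vanish at `(k, 1)` for all `k ≥ 1`. It is then a one-variable
-- polynomial with infinitely many roots, and its coefficient at `a₀` is a nonzero multiple of `c a₀
-- b₀`.
open Filter Topology in
theorem coeff_eq_zero_of_growth {F : ℕ → ℕ → ℤ} {N₀ D d : ℕ} {c : ℕ → ℕ → ℤ}
    (hF : ∀ x y, F (N₀ + x) (N₀ + y) =
      ∑ a ∈ Finset.range D, ∑ b ∈ Finset.range D, c a b * (x.choose a * y.choose b))
    {L : ℕ → ℕ → ℝ} (hL : ∀ k l, 1 ≤ k → 1 ≤ l →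
      Tendsto (fun N : ℕ => (F (N * k) (N * l) : ℝ) / (N : ℝ) ^ d) atTop (𝓝 (L k l))) :
    ∀ a < D, ∀ b < D, d < a + b → c a b = 0 := by
  intro a₁ ha₁ b₁ hb₁ hab₁
  by_contra hne₁
  let T := ((Finset.range D) ×ˢ (Finset.range D)).filter fun q => d < q.1 + q.2 ∧ c q.1 q.2 ≠ 0
  obtain ⟨⟨a₀, b₀⟩, hq, hmax⟩ := T.exists_max_image (fun q => q.1 + q.2)
    ⟨(a₁, b₁), by simp [T, *]⟩
  simp only [T, Finset.mem_filter, Finset.mem_product, Finset.mem_range, Prod.forall] at hq hmax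
  obtain ⟨⟨ha₀, hb₀⟩, hd, hne⟩ := hq
  have hc : ∀ a < D, ∀ b < D, a₀ + b₀ < a + b → c a b = 0 := fun a ha b hb h => by
    by_contra hab
    have := hmax a b ⟨⟨ha, hb⟩, by omega, hab⟩
    omega
  let p : Polynomial ℝ := ∑ a ∈ Finset.range D, ∑ b ∈ Finset.range D, if a + b = a₀ + b₀ then
    Polynomial.monomial a ((c a b : ℝ) / a ! / b !) else 0
  have hroot : ∀ k : ℕ, 1 ≤ k → p.eval (k : ℝ) = 0 := fun k hk => by
    have h1 := tendsto_div_pow_of_choose_expansion hF hc hk le_rfl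
    have h2 : Tendsto (fun N : ℕ => (F (N * k) (N * 1) : ℝ) / (N : ℝ) ^ (a₀ + b₀)) atTop
        (𝓝 0) := by
      have h0 : Tendsto (fun N : ℕ => (N : ℝ) ^ d / (N : ℝ) ^ (a₀ + b₀)) atTop (𝓝 0) :=
        (tendsto_pow_div_pow_atTop_zero hd).comp tendsto_natCast_atTop_atTop
      have := (hL k 1 hk le_rfl).mul h0
      rw [mul_zero] at this
      refine this.congr' ?_
      filter_upwards [eventually_ge_atTop 1] with N hN
      have : N ≠ 0 := by omega
      have hN0 : (N : ℝ) ≠ 0 := by exact_mod_cast this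
      field_simp
    have h3 := tendsto_nhds_unique h1 h2
    rw [← h3]
    simp only [p, Polynomial.eval_finsetSum]
    refine Finset.sum_congr rfl fun a _ => Finset.sum_congr rfl fun b _ => ?_
    split_ifs
    · simp only [Polynomial.eval_monomial, Nat.cast_one, one_pow]; ring
    · simp
  have hp : p = 0 := by
    refine Polynomial.eq_zero_of_infinite_isRoot p (Set.Infinite.mono
      (s := (fun k : ℕ => (k : ℝ)) '' Set.Ici 1) ?_ ((Set.Ici_infinite 1).image Nat.cast_injective.injOn))
    rintro _ ⟨k, hk, rfl⟩
    exact hroot k hk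
  have hcoef : p.coeff a₀ = (c a₀ b₀ : ℝ) / a₀ ! / b₀ ! := by
    simp only [p, Polynomial.finsetSum_coeff]
    rw [Finset.sum_eq_single a₀, Finset.sum_eq_single b₀]
    · simp
    · intro b _ hb
      rw [if_neg (by omega)]; simp
    · intro h; exact absurd (Finset.mem_range.2 hb₀) h
    · intro a _ ha
      refine Finset.sum_eq_zero fun b _ => ?_
      split_ifs
      · exact Polynomial.coeff_monomial_of_ne _ ha.symm
      · simp
    · intro h; exact absurd (Finset.mem_range.2 ha₀) h
  rw [hp, Polynomial.coeff_zero] at hcoef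
  have h1 : (a₀ ! : ℝ) ≠ 0 := by exact_mod_cast a₀.factorial_ne_zero
  have h2 : (b₀ ! : ℝ) ≠ 0 := by exact_mod_cast b₀.factorial_ne_zero
  have : (c a₀ b₀ : ℝ) = 0 := by
    field_simp at hcoef
    linarith
  exact hne (by exact_mod_cast this)

open Filter Topology in
/-- The leading form of an eventually polynomial function of growth `N ^ d` is, up to `d!`, an
integral combination of the terms of the binomial expansion. -/
theorem exists_leadingForm {F : ℕ → ℕ → ℤ} (hF : F ∈ eventuallyPoly₂) {d : ℕ}
    {L : ℕ → ℕ → ℝ} (hL : ∀ k l, 1 ≤ k → 1 ≤ l →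
      Tendsto (fun N : ℕ => (F (N * k) (N * l) : ℝ) / (N : ℝ) ^ d) atTop (𝓝 (L k l))) :
    ∃ c : ℕ → ℤ, ∀ k l, 1 ≤ k → 1 ≤ l → (d ! : ℝ) * L k l =
      ∑ a ∈ Finset.range (d + 1), (c a * d.choose a : ℝ) * ((k : ℝ) ^ a * (l : ℝ) ^ (d - a)) := by
  obtain ⟨N₀, h⟩ := exists_choose_expansion₂ hF
  obtain ⟨D₀, h⟩ := h N₀ le_rfl
  -- Length at least `d + 1` ensures that the summation range contains the whole diagonal `a + b =
  -- d`.
  obtain ⟨c, h⟩ := h (max D₀ (d + 1)) (le_max_left _ _)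
  have hD : d < max D₀ (d + 1) := lt_of_lt_of_le d.lt_succ_self (le_max_right _ _)
  have hc := coeff_eq_zero_of_growth h hL
  refine ⟨fun a => c a (d - a), fun k l hk hl => ?_⟩
  rw [tendsto_nhds_unique (hL k l hk hl) (tendsto_div_pow_of_choose_expansion h hc hk hl),
    sum_sum_ite_add_eq hD, Finset.mul_sum]
  refine Finset.sum_congr rfl fun a ha => ?_
  rw [Nat.cast_choose ℝ (Nat.lt_succ_iff.1 (Finset.mem_range.1 ha))]
  have h1 : (a ! : ℝ) ≠ 0 := by exact_mod_cast a.factorial_ne_zero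
  have h2 : ((d - a)! : ℝ) ≠ 0 := by exact_mod_cast (d - a).factorial_ne_zero
  field_simp

open Filter Topology in
theorem tendsto_sum_pow_div (d : ℕ) (c : ℕ → ℝ) :
    Tendsto (fun M : ℕ => (∑ a ∈ Finset.range (d + 1), c a * (M : ℝ) ^ a) / (M : ℝ) ^ d) atTop
      (𝓝 (c d)) := by
  have h : ∀ a ∈ Finset.range (d + 1), Tendsto (fun M : ℕ => c a * ((M : ℝ) ^ a / (M : ℝ) ^ d))
      atTop (𝓝 (if a = d then c d else 0)) := fun a ha => by
    split_ifs with h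
    · subst h
      refine tendsto_const_nhds.congr' ?_
      filter_upwards [eventually_ge_atTop 1] with N hN
      have : N ≠ 0 := by omega
      rw [div_self (pow_ne_zero _ (by exact_mod_cast this)), mul_one]
    · rw [Finset.mem_range] at ha
      have h0 : Tendsto (fun N : ℕ => (N : ℝ) ^ a / (N : ℝ) ^ d) atTop (𝓝 0) :=
        (tendsto_pow_div_pow_atTop_zero (by omega)).comp tendsto_natCast_atTop_atTop
      simpa using h0.const_mul (c a)
  have := tendsto_finsetSum _ h
  simp only [Finset.sum_ite_eq', Finset.mem_range, Nat.lt_succ_self, if_true] at this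
  refine this.congr fun M => ?_
  rw [Finset.sum_div]
  exact Finset.sum_congr rfl fun a _ => by ring

/-! ### Volumes of lattice polytopes -/

theorem convex_of_mem_polytopes {n : ℕ} {S A : Set (Fin n → ℝ)} (hA : A ∈ polytopes S) :
    Convex ℝ A := by
  obtain ⟨V, -, -, rfl⟩ := hA
  exact convex_convexHull ℝ _

theorem isCompact_of_mem_polytopes {n : ℕ} {S A : Set (Fin n → ℝ)} (hA : A ∈ polytopes S) :
    IsCompact A := by
  obtain ⟨V, -, -, rfl⟩ := hA
  exact V.finite_toSet.isCompact_convexHull ℝ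

theorem nonempty_of_mem_polytopes {n : ℕ} {S A : Set (Fin n → ℝ)} (hA : A ∈ polytopes S) :
    A.Nonempty := by
  obtain ⟨V, hV, -, rfl⟩ := hA
  exact Set.Nonempty.convexHull hV

theorem span_basisFun_eq_intLattice (d : ℕ) :
    (Submodule.span ℤ (Set.range (Pi.basisFun ℝ (Fin d))) : Set (Fin d → ℝ)) = intLattice d := by
  ext x
  rw [SetLike.mem_coe, Module.Basis.mem_span_iff_repr_mem]
  simp only [Pi.basisFun_repr, intLattice, Set.mem_range, eq_intCast]
  constructor
  · intro h
    choose z hz using h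
    exact ⟨z, funext hz⟩
  · rintro ⟨z, rfl⟩ i
    exact ⟨z i, rfl⟩

-- A convex set has null frontier, so its volume is the limit of lattice point counts at mesh `1 /
-- N`.
open Filter Topology in
theorem tendsto_ncard_latticePoints {d : ℕ} {s : Set (Fin d → ℝ)} (hc : IsCompact s)
    (hs : Convex ℝ s) :
    Tendsto (fun N : ℕ => (({z | intEmb d z ∈ (N : ℝ) • s}).ncard : ℝ) / (N : ℝ) ^ d) atTop
      (𝓝 (volume.real s)) := by
  have h := tendsto_card_div_pow_atTop_volume s hc.isBounded hc.measurableSet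
    (hs.addHaar_frontier volume)
  rw [Fintype.card_fin] at h
  refine h.congr' ?_
  filter_upwards [eventually_ge_atTop 1] with N hN
  have hN0 : (N : ℝ) ≠ 0 := by
    have : N ≠ 0 := by omega
    exact_mod_cast this
  congr 2
  rw [Nat.card_coe_set_eq, span_basisFun_eq_intLattice]
  have hinj : Function.Injective fun z : Fin d → ℤ => (N : ℝ)⁻¹ • intEmb d z := fun z w h =>
    intEmb_injective d (smul_right_injective _ (inv_ne_zero hN0) h)
  rw [← Set.ncard_image_of_injective _ hinj]
  congr 1
  ext x
  constructor
  · rintro ⟨hx, _, ⟨z, rfl⟩, rfl⟩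
    exact ⟨z, ⟨_, hx, smul_inv_smul₀ hN0 _⟩, rfl⟩
  · rintro ⟨z, ⟨y, hy, hz⟩, rfl⟩
    refine ⟨?_, intEmb d z, ⟨z, rfl⟩, rfl⟩
    show (N : ℝ)⁻¹ • intEmb d z ∈ s
    rw [← hz]
    simpa only [inv_smul_smul₀ hN0] using hy

-- After rescaling, `A + M⁻¹ • B` lies between a translate of `A` and a closed thickening of `A` of
-- radius tending to zero. This isolates the pure volumes in the expansion of `kA + lB`.
open Filter Topology in
theorem tendsto_volume_smul_add_div {d : ℕ} {A B : Set (Fin d → ℝ)} (hA : IsCompact A)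
    (hB : IsCompact B) (hB' : B.Nonempty) :
    Tendsto (fun M : ℕ => volume.real ((M : ℝ) • A + B) / (M : ℝ) ^ d) atTop
      (𝓝 (volume.real A)) := by
  have hlim : Tendsto (fun M : ℕ => volume (A + (M : ℝ)⁻¹ • B)) atTop (𝓝 (volume A)) := by
    obtain ⟨C, hC⟩ := hB.isBounded.exists_norm_le
    have hC0 : Tendsto (fun M : ℕ => (M : ℝ)⁻¹ * C) atTop (𝓝 0) := by
      simpa using (tendsto_inv_atTop_zero.comp tendsto_natCast_atTop_atTop).mul_const C
    refine tendsto_of_tendsto_of_tendsto_of_le_of_le tendsto_const_nhds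
      ((tendsto_measure_cthickening_of_isCompact (μ := volume) hA).comp hC0)
      (fun M => ?_) fun M => ?_
    · obtain ⟨b, hb⟩ := hB'
      calc volume A = volume ((M : ℝ)⁻¹ • b +ᵥ A) := (measure_vadd _ _ _).symm
        _ ≤ _ := measure_mono ?_
      rintro _ ⟨a, ha, rfl⟩
      exact ⟨a, ha, _, ⟨b, hb, rfl⟩, add_comm _ _⟩
    · refine measure_mono ?_
      rintro _ ⟨a, ha, _, ⟨b, hb, rfl⟩, rfl⟩
      refine Metric.mem_cthickening_of_dist_le _ a _ _ ha ?_
      rw [dist_eq_norm]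
      simp only [add_sub_cancel_left, norm_smul, norm_inv, RCLike.norm_natCast]
      exact mul_le_mul_of_nonneg_left (hC b hb) (by positivity)
  have hlim' := (ENNReal.tendsto_toReal hA.measure_ne_top).comp hlim
  refine hlim'.congr' ?_
  filter_upwards [eventually_ge_atTop 1] with M hM
  have hM0 : (M : ℝ) ≠ 0 := by
    have : M ≠ 0 := by omega
    exact_mod_cast this
  have hset : (M : ℝ) • A + B = (M : ℝ) • (A + (M : ℝ)⁻¹ • B) := by
    rw [smul_add, smul_inv_smul₀ hM0]
  rw [hset, Measure.real, Measure.addHaar_smul, ENNReal.toReal_mul, ENNReal.toReal_ofReal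
    (abs_nonneg _), Module.finrank_fin_fun, abs_of_nonneg (by positivity),
    mul_div_cancel_left₀ _ (pow_ne_zero _ hM0)]
  rfl

/-- Integrality of the mixed volumes of two lattice polytopes. -/
theorem exists_mixedVolume {d : ℕ} {A B : Set (Fin d → ℝ)} (hA : A ∈ polytopes (intLattice d))
    (hB : B ∈ polytopes (intLattice d)) :
    ∃ c : ℕ → ℤ, (d ! : ℝ) * volume.real A = c d ∧ (d ! : ℝ) * volume.real B = c 0 ∧
      (d ! : ℝ) * volume.real (A + B) =
        ((∑ a ∈ Finset.range (d + 1), c a * (d.choose a : ℤ) : ℤ) : ℝ) := by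
  have hcA := isCompact_of_mem_polytopes hA
  have hcB := isCompact_of_mem_polytopes hB
  obtain ⟨c, hc⟩ := exists_leadingForm (ncard_latticePoints_mem hA hB) (d := d)
    (L := fun k l => volume.real ((k : ℝ) • A + (l : ℝ) • B)) fun k l _ _ => by
      refine (tendsto_ncard_latticePoints ((hcA.smul (k : ℝ)).add (hcB.smul (l : ℝ)))
        (((convex_of_mem_polytopes hA).smul _).add ((convex_of_mem_polytopes hB).smul _))).congr
          fun N => ?_
      simp only [smul_add, smul_smul, Nat.cast_mul, Int.cast_natCast]
  refine ⟨c, ?_, ?_, ?_⟩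
  -- The expansion is known only for `k, l ≥ 1`, so `l = 0` is not available; `c d` is obtained with
  -- `l = 1` and `k → ∞`, and symmetrically `c 0` below.
  · have h1 := (tendsto_volume_smul_add_div hcA hcB (nonempty_of_mem_polytopes hB)).const_mul
      (d ! : ℝ)
    have h2 := tendsto_sum_pow_div d fun a => c a * (d.choose a : ℝ)
    simp only [Nat.choose_self, Nat.cast_one, mul_one] at h2
    refine tendsto_nhds_unique (h1.congr' ?_) h2
    filter_upwards [Filter.eventually_ge_atTop 1] with M hM
    have := hc M 1 hM le_rfl
    simp only [Nat.cast_one, one_smul, one_pow, mul_one] at this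
    rw [← mul_div_assoc, this]
  · have h1 := (tendsto_volume_smul_add_div hcB hcA (nonempty_of_mem_polytopes hA)).const_mul
      (d ! : ℝ)
    have h2 := tendsto_sum_pow_div d fun a => c (d - a) * (d.choose a : ℝ)
    simp only [Nat.choose_self, Nat.cast_one, mul_one, Nat.sub_self] at h2
    refine tendsto_nhds_unique (h1.congr' ?_) h2
    filter_upwards [Filter.eventually_ge_atTop 1] with M hM
    have := hc 1 M le_rfl hM
    simp only [Nat.cast_one, one_smul, one_pow, one_mul] at this
    rw [← mul_div_assoc, add_comm, this, ← Finset.sum_range_reflect]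
    congr 1
    refine Finset.sum_congr rfl fun a ha => ?_
    have ha' : a ≤ d := Nat.lt_succ_iff.1 (Finset.mem_range.1 ha)
    rw [show d + 1 - 1 - a = d - a by omega, Nat.choose_symm ha', Nat.sub_sub_self ha']
  · have := hc 1 1 le_rfl le_rfl
    simp only [Nat.cast_one, one_smul, one_pow, mul_one] at this
    rw [this]
    push_cast
    rfl

theorem exists_nat_factorial_mul_volume {d : ℕ} {A : Set (Fin d → ℝ)}
    (hA : A ∈ polytopes (intLattice d)) : ∃ v : ℕ, (d ! : ℝ) * volume.real A = v := by
  obtain ⟨c, h, -⟩ := exists_mixedVolume hA hA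
  have h0 : (0 : ℝ) ≤ c d := by rw [← h]; positivity
  obtain ⟨v, hv⟩ := Int.eq_ofNat_of_zero_le (Int.cast_nonneg_iff.1 h0)
  exact ⟨v, by rw [h, hv]; rfl⟩

/-- Only the two extreme terms of the mixed volume expansion survive mod `p`, because `p` divides
`(p ^ t).choose a` for `0 < a < p ^ t`. -/
theorem volume_add_modEq {d p t : ℕ} (hp : p.Prime) (hd : d = p ^ t) {A B : Set (Fin d → ℝ)}
    (hA : A ∈ polytopes (intLattice d)) (hB : B ∈ polytopes (intLattice d)) {u v w : ℕ}
    (hu : (d ! : ℝ) * volume.real A = u) (hv : (d ! : ℝ) * volume.real B = v)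
    (hw : (d ! : ℝ) * volume.real (A + B) = w) : w ≡ u + v [MOD p] := by
  obtain ⟨c, h1, h2, h3⟩ := exists_mixedVolume hA hB
  have hu' : (u : ℤ) = c d := by exact_mod_cast hu.symm.trans h1
  have hv' : (v : ℤ) = c 0 := by exact_mod_cast hv.symm.trans h2
  have hw' : (w : ℤ) = ∑ a ∈ Finset.range (d + 1), c a * (d.choose a : ℤ) := by
    exact_mod_cast hw.symm.trans h3
  have hd0 : 0 < d := hd ▸ pow_pos hp.pos t
  rw [← Int.natCast_modEq_iff, Nat.cast_add, hw', hu', hv', Finset.sum_range_succ]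
  obtain ⟨e, rfl⟩ : ∃ e, d = e + 1 := ⟨d - 1, by omega⟩
  rw [Finset.sum_range_succ']
  simp only [Nat.choose_zero_right, Nat.choose_self, Nat.cast_one, mul_one]
  have hz : (p : ℤ) ∣ ∑ a ∈ Finset.range e, c (a + 1) * ((e + 1).choose (a + 1) : ℤ) := by
    refine Finset.dvd_sum fun a ha => Dvd.dvd.mul_left ?_ _
    rw [Finset.mem_range] at ha
    have := hp.dvd_choose_pow (n := t) (k := a + 1) (by omega) (by omega)
    rw [← hd] at this
    exact_mod_cast this
  refine (Int.modEq_iff_dvd.2 ?_)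
  obtain ⟨q, hq⟩ := hz
  exact ⟨-q, by rw [hq]; ring⟩

theorem add_mem_polytopes {d : ℕ} {A B : Set (Fin d → ℝ)} (hA : A ∈ polytopes (intLattice d))
    (hB : B ∈ polytopes (intLattice d)) : A + B ∈ polytopes (intLattice d) := by
  classical
  obtain ⟨V, hV, hVS, rfl⟩ := hA
  obtain ⟨W, hW, hWS, rfl⟩ := hB
  refine ⟨V + W, hV.add hW, ?_, ?_⟩
  · rw [Finset.coe_add]
    rintro _ ⟨v, hv, w, hw, rfl⟩
    obtain ⟨a, rfl⟩ := hVS hv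
    obtain ⟨b, rfl⟩ := hWS hw
    exact ⟨a + b, funext fun i => by simp⟩
  · rw [Finset.coe_add, convexHull_add]

theorem zero_mem_polytopes (d : ℕ) : (0 : Set (Fin d → ℝ)) ∈ polytopes (intLattice d) :=
  ⟨{0}, Finset.singleton_nonempty _, by
    simpa using ⟨0, funext fun i => by simp⟩, by simp [Set.singleton_zero]⟩

theorem sum_mem_polytopes {d : ℕ} {ι : Type*} (s : Finset ι) {A : ι → Set (Fin d → ℝ)}
    (hA : ∀ i, A i ∈ polytopes (intLattice d)) : ∑ i ∈ s, A i ∈ polytopes (intLattice d) := by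
  classical
  induction s using Finset.induction_on with
  | empty => simpa using zero_mem_polytopes d
  | insert i s hi ih => rw [Finset.sum_insert hi]; exact add_mem_polytopes (hA i) ih

theorem volume_sum_modEq {d p t : ℕ} (hp : p.Prime) (hd : d = p ^ t) {ι : Type*} (s : Finset ι)
    {A : ι → Set (Fin d → ℝ)} (hA : ∀ i, A i ∈ polytopes (intLattice d)) {u : ι → ℕ}
    (hu : ∀ i, (d ! : ℝ) * volume.real (A i) = u i) {w : ℕ}
    (hw : (d ! : ℝ) * volume.real (∑ i ∈ s, A i) = w) : w ≡ ∑ i ∈ s, u i [MOD p] := by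
  classical
  induction s using Finset.induction_on generalizing w with
  | empty =>
    -- The empty Minkowski sum is the point `0`, which has volume zero only because `d > 0`.
    have hd0 : 0 < d := hd ▸ pow_pos hp.pos t
    have : Nonempty (Fin d) := ⟨⟨0, hd0⟩⟩
    rw [Finset.sum_empty, ← Set.singleton_zero, Measure.real, measure_singleton] at hw
    have : w = 0 := by exact_mod_cast (by simpa using hw.symm : (w : ℝ) = 0)
    rw [this, Finset.sum_empty]
  | insert i s hi ih =>
    obtain ⟨v, hv⟩ := exists_nat_factorial_mul_volume (sum_mem_polytopes s hA)
    rw [Finset.sum_insert hi] at hw ⊢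
    exact (volume_add_modEq hp hd (hA i) (sum_mem_polytopes s hA) (hu i) hv hw).trans
      ((ih hv).add_left _)

/-! ### Reduction to full-dimensional polytopes -/

/-- A linear parametrization of a rational subspace that respects the lattices. -/
theorem exists_linear_latticeParam {n d : ℕ} {W : Submodule ℝ (Fin n → ℝ)}
    (hd : Module.finrank ℝ W = d)
    (hW : W ≤ Submodule.span ℝ ((W : Set (Fin n → ℝ)) ∩ intLattice n)) :
    ∃ T : (Fin d → ℝ) →ₗ[ℝ] (Fin n → ℝ), Function.Injective T ∧ LinearMap.range T = W ∧
      T '' intLattice d = (W : Set (Fin n → ℝ)) ∩ intLattice n := by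
  let L₀ := Submodule.span ℤ (Set.range (Pi.basisFun ℝ (Fin n)))
  -- The lattice points of `W` form a discrete subgroup, of full rank by `hW`; hence a `ℤ`-basis of
  -- it is an `ℝ`-basis of `W`, and its coordinates give `T`.
  let L : Submodule ℤ W := ZLattice.comap ℝ L₀ W.subtype
  have hdisc : DiscreteTopology L :=
    ZLattice.comap_discreteTopology ℝ L₀ W.subtype.continuous_of_finiteDimensional
      W.injective_subtype
  have hLmem : ∀ w : W, w ∈ L ↔ (w : Fin n → ℝ) ∈ intLattice n := fun w => by
    rw [← span_basisFun_eq_intLattice]; rfl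
  have hlat : IsZLattice ℝ L := ⟨by
    refine Submodule.map_injective_of_injective W.injective_subtype ?_
    rw [Submodule.map_top, Submodule.range_subtype, Submodule.map_span]
    refine le_antisymm (Submodule.span_le.2 ?_) (hW.trans (Submodule.span_mono ?_))
    · rintro _ ⟨w, -, rfl⟩
      exact w.2
    · rintro w ⟨hw, hwn⟩
      exact ⟨⟨w, hw⟩, (hLmem _).2 hwn, rfl⟩⟩
  have hrank : Module.finrank ℤ L = d := (ZLattice.rank ℝ L).trans hd
  let b := (Module.finBasisOfFinrankEq ℤ L hrank).ofZLatticeBasis ℝ L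
  have hb : ∀ w : W, w ∈ L ↔ ∀ i, b.repr w i ∈ Set.range (algebraMap ℤ ℝ) := fun w => by
    rw [← Module.Basis.mem_span_iff_repr_mem, Module.Basis.ofZLatticeBasis_span]
  refine ⟨W.subtype ∘ₗ b.equivFun.symm.toLinearMap, ?_, ?_, ?_⟩
  · exact W.injective_subtype.comp b.equivFun.symm.injective
  · rw [LinearMap.range_comp, LinearEquiv.range, Submodule.map_top, Submodule.range_subtype]
  · ext w
    constructor
    · rintro ⟨_, ⟨z, rfl⟩, rfl⟩
      refine ⟨Subtype.prop _, (hLmem _).1 ((hb _).2 fun i => ⟨z i, ?_⟩)⟩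
      rw [← Module.Basis.equivFun_apply]
      exact (congrFun (b.equivFun.apply_symm_apply fun j => (z j : ℝ)) i).symm
    · rintro ⟨hw, hwn⟩
      have := (hb ⟨w, hw⟩).1 ((hLmem _).2 hwn)
      choose z hz using this
      refine ⟨_, ⟨z, rfl⟩, ?_⟩
      have hz' : (fun i => (z i : ℝ)) = b.equivFun ⟨w, hw⟩ := funext fun i => by
        rw [Module.Basis.equivFun_apply, ← hz]; rfl
      simp [hz']

theorem sub_mem_intLattice {n : ℕ} {v w : Fin n → ℝ} (hv : v ∈ intLattice n)
    (hw : w ∈ intLattice n) : v - w ∈ intLattice n := by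
  rw [← range_intEmb] at *
  obtain ⟨a, rfl⟩ := hv
  obtain ⟨b, rfl⟩ := hw
  exact ⟨a - b, map_sub _ _ _⟩

theorem add_mem_intLattice {n : ℕ} {v w : Fin n → ℝ} (hv : v ∈ intLattice n)
    (hw : w ∈ intLattice n) : v + w ∈ intLattice n := by
  rw [← range_intEmb] at *
  obtain ⟨a, rfl⟩ := hv
  obtain ⟨b, rfl⟩ := hw
  exact ⟨a + b, map_add _ _ _⟩

theorem sum_mem_intLattice {n : ℕ} {ι : Type*} (s : Finset ι) {v : ι → Fin n → ℝ}
    (hv : ∀ i, v i ∈ intLattice n) : ∑ i ∈ s, v i ∈ intLattice n := by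
  choose z hz using hv
  exact ⟨∑ i ∈ s, z i, by ext j; simp [Finset.sum_apply, ← hz]⟩

/-- The normalized volume of a lattice polytope in terms of a linear parametrization. -/
theorem normalizedVolume_image {n d : ℕ} {T : (Fin d → ℝ) →ₗ[ℝ] (Fin n → ℝ)}
    (hT : Function.Injective T)
    (hTlat : T '' intLattice d = (LinearMap.range T : Set (Fin n → ℝ)) ∩ intLattice n)
    {v : Fin n → ℝ} (hv : v ∈ intLattice n) {A : Set (Fin d → ℝ)} (hA : A.Nonempty) :
    normalizedVolume d ((fun x => T x + v) '' A) = (d ! : ℝ) * volume.real A := by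
  let τ : (Fin d → ℝ) →ᵃ[ℝ] (Fin n → ℝ) := T.toAffineMap + AffineMap.const ℝ _ v
  have hτ : (fun x => T x + v) = τ := rfl
  have hinj : Function.Injective τ := fun x y h => hT (add_right_cancel h)
  have hlin : τ.linear = T := by ext; simp [τ]
  rw [hτ]
  have hspan : affineSpan ℝ (τ '' A) = (affineSpan ℝ A).map τ := (AffineSubspace.map_span τ A).symm
  have hdim : dim (τ '' A) = Module.finrank ℝ (affineSpan ℝ A).direction := by
    rw [dim, hspan, AffineSubspace.map_direction, hlin]
    exact (Submodule.equivMapOfInjective T hT _).finrank_eq.symm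
  by_cases h : affineSpan ℝ A = ⊤
  · have hd : dim (τ '' A) = d := by
      rw [hdim, h, AffineSubspace.direction_top, finrank_top, Module.finrank_fin_fun]
    have hparam : IsLatticeParam (τ '' A) τ := by
      have hr : Set.range τ = (affineSpan ℝ (τ '' A) : Set (Fin n → ℝ)) := by
        rw [hspan, h, AffineSubspace.coe_map, AffineSubspace.top_coe, Set.image_univ]
      refine ⟨hinj, hr, ?_⟩
      rw [← hr]
      ext w
      constructor
      · rintro ⟨x, hx, rfl⟩
        have : T x ∈ T '' intLattice d := ⟨x, hx, rfl⟩
        rw [hTlat] at this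
        exact ⟨⟨x, rfl⟩, add_mem_intLattice this.2 hv⟩
      · rintro ⟨⟨x, rfl⟩, hx⟩
        have h1 : T x ∈ intLattice n := by
          have := sub_mem_intLattice hx hv
          rwa [← hτ, add_sub_cancel_right] at this
        have : T x ∈ T '' intLattice d := by rw [hTlat]; exact ⟨⟨x, rfl⟩, h1⟩
        obtain ⟨y, hy, hyx⟩ := this
        exact ⟨x, hT hyx ▸ hy, rfl⟩
    rw [normalizedVolume_eq hd hparam, Set.preimage_image_eq _ hinj]
  -- If `A` does not span, both sides are zero: the image has the wrong dimension and `A` lies in a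
  -- proper affine subspace.
  · have hd : dim (τ '' A) ≠ d := fun hd => h <| by
      rw [← AffineSubspace.direction_eq_top_iff_of_nonempty ((affineSpan_nonempty ℝ).2 hA)]
      refine Submodule.eq_top_of_finrank_eq ?_
      rw [← hdim, hd, Module.finrank_fin_fun]
    have hvol : volume A = 0 := measure_mono_null (subset_affineSpan ℝ A)
      (Measure.addHaar_affineSubspace volume _ h)
    rw [normalizedVolume, dif_neg fun h => hd h.1, Measure.real, hvol]
    simp

/-- Translating by a vertex `v` moves all vertices to lattice points of the range of `T`, which lift
to integral points; convex hulls commute with affine maps. -/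
theorem exists_polytope_image {n d : ℕ} {T : (Fin d → ℝ) →ₗ[ℝ] (Fin n → ℝ)}
    (hTlat : T '' intLattice d = (LinearMap.range T : Set (Fin n → ℝ)) ∩ intLattice n)
    {P : Set (Fin n → ℝ)} (hP : P ∈ polytopes (intLattice n))
    (hPT : ∀ x ∈ P, ∀ y ∈ P, x - y ∈ LinearMap.range T) :
    ∃ v ∈ intLattice n, ∃ A ∈ polytopes (intLattice d), P = (fun x => T x + v) '' A := by
  classical
  obtain ⟨V, ⟨v, hv⟩, hVS, rfl⟩ := hP
  have hsub := subset_convexHull ℝ (V : Set (Fin n → ℝ))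
  have hex : ∀ w : V, ∃ x ∈ intLattice d, T x = w - v := fun w => by
    have : (w : Fin n → ℝ) - v ∈ T '' intLattice d := by
      rw [hTlat]
      exact ⟨hPT _ (hsub w.2) _ (hsub hv), sub_mem_intLattice (hVS w.2) (hVS hv)⟩
    exact this
  choose f hf hfT using hex
  refine ⟨v, hVS hv, convexHull ℝ (Finset.univ.image f : Finset _), ⟨_, ?_, ?_, rfl⟩, ?_⟩
  · exact ⟨f ⟨v, hv⟩, Finset.mem_image_of_mem f (Finset.mem_univ _)⟩
  · rw [Finset.coe_image, Finset.coe_univ, Set.image_univ]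
    rintro _ ⟨w, rfl⟩
    exact hf w
  · have himg := AffineMap.image_convexHull
      (T.toAffineMap + AffineMap.const ℝ _ v) (Set.range f)
    rw [Finset.coe_image, Finset.coe_univ, Set.image_univ]
    refine Eq.trans ?_ himg.symm
    congr 1
    rw [← Set.range_comp]
    ext w
    simp [hfT]

theorem sum_image_add_eq {n d : ℕ} (T : (Fin d → ℝ) →ₗ[ℝ] (Fin n → ℝ)) {ι : Type*} (s : Finset ι)
    (v : ι → Fin n → ℝ) (A : ι → Set (Fin d → ℝ)) :
    ∑ i ∈ s, (fun x => T x + v i) '' A i = (fun x => T x + ∑ i ∈ s, v i) '' ∑ i ∈ s, A i := by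
  classical
  induction s using Finset.induction_on with
  | empty => ext; simp
  | insert i s hi ih =>
    rw [Finset.sum_insert hi, Finset.sum_insert hi, Finset.sum_insert hi, ih]
    ext w
    constructor
    · rintro ⟨_, ⟨a, ha, rfl⟩, _, ⟨b, hb, rfl⟩, rfl⟩
      exact ⟨a + b, ⟨a, ha, b, hb, rfl⟩, by simp only [map_add]; abel⟩
    · rintro ⟨_, ⟨a, ha, b, hb, rfl⟩, rfl⟩
      exact ⟨_, ⟨a, ha, rfl⟩, _, ⟨b, hb, rfl⟩, by simp only [map_add]; abel⟩

/-- With points fixed in all other summands, moving from `y` to `x` within `P i` changes the total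
by exactly `x - y`. -/
theorem sub_mem_direction_sum {n : ℕ} {ι : Type*} [Fintype ι] {P : ι → Set (Fin n → ℝ)}
    (hP : ∀ i, (P i).Nonempty) (i : ι) {x y : Fin n → ℝ} (hx : x ∈ P i) (hy : y ∈ P i) :
    x - y ∈ (affineSpan ℝ (∑ i, P i)).direction := by
  classical
  choose q hq using hP
  have hmem : ∀ z ∈ P i, ∑ j, Function.update q i z j ∈ ∑ j, P j := fun z hz =>
    Set.finsetSum_mem_finsetSum _ _ _ fun j _ => by
      by_cases h : j = i
      · subst h; simpa using hz
      · simpa [h] using hq j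
  have h := AffineSubspace.vsub_mem_direction (subset_affineSpan ℝ _ (hmem x hx))
    (subset_affineSpan ℝ _ (hmem y hy))
  simpa [Finset.sum_update_of_mem (Finset.mem_univ i)] using h

theorem direction_le_span_inter_intLattice {n : ℕ} {P : Set (Fin n → ℝ)}
    (hP : P ∈ polytopes (intLattice n)) :
    (affineSpan ℝ P).direction ≤
      Submodule.span ℝ (((affineSpan ℝ P).direction : Set (Fin n → ℝ)) ∩ intLattice n) := by
  obtain ⟨V, -, hVS, rfl⟩ := hP
  rw [affineSpan_convexHull, direction_affineSpan]
  conv_lhs => rw [vectorSpan_def]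
  refine Submodule.span_mono ?_
  rintro _ ⟨v, hv, w, hw, rfl⟩
  exact ⟨vsub_mem_vectorSpan ℝ hv hw, sub_mem_intLattice (hVS hv) (hVS hw)⟩

end LatticeVolume

theorem mainTheorem7 (n d p t m : ℕ) (hp : p.Prime) (hd : d = p ^ t) (hdn : d ≤ n)
    (P : Fin m → Set (Fin n → ℝ))
    (hP : ∀ i, P i ∈ LatticeVolume.polytopesOfDimLE d (LatticeVolume.intLattice n))
    (hsum : ∑ i, P i ∈ LatticeVolume.polytopesOfDimLE d (LatticeVolume.intLattice n)) :
    ∃ (v : ℕ) (w : Fin m → ℕ),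
      LatticeVolume.normalizedVolume d (∑ i, P i) = (v : ℝ) ∧
      (∀ i, LatticeVolume.normalizedVolume d (P i) = (w i : ℝ)) ∧
      v ≡ ∑ i, w i [MOD p] := by
  have hne : ∀ i, (P i).Nonempty := fun i => LatticeVolume.nonempty_of_mem_polytopes (hP i).1
  have hdir := fun i x (hx : x ∈ P i) y (hy : y ∈ P i) =>
    LatticeVolume.sub_mem_direction_sum hne i hx hy
  rcases hsum.2.lt_or_eq with hlt | heq
  · have hzero : ∀ Q : Set (Fin n → ℝ), LatticeVolume.dim Q < d →
        LatticeVolume.normalizedVolume d Q = 0 := fun Q hQ => by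
      rw [LatticeVolume.normalizedVolume, dif_neg fun h => hQ.ne h.1]
    refine ⟨0, 0, by simpa using hzero _ hlt, fun i => ?_, by simp [Nat.ModEq]⟩
    -- The direction of each summand lies in that of the sum, so every `P i` also has dimension
    -- below `d`.
    refine (hzero _ (lt_of_le_of_lt (Submodule.finrank_mono ?_) hlt)).trans (by simp)
    rw [direction_affineSpan, vectorSpan_def]
    refine Submodule.span_le.2 ?_
    rintro _ ⟨x, hx, y, hy, rfl⟩
    exact hdir i x hx y hy
  · obtain ⟨T, hT, hTr, hTlat⟩ := LatticeVolume.exists_linear_latticeParam heq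
      (LatticeVolume.direction_le_span_inter_intLattice hsum.1)
    rw [← hTr] at hTlat hdir
    choose v hv A hA hPA using fun i =>
      LatticeVolume.exists_polytope_image hTlat (hP i).1 (hdir i)
    have hS := LatticeVolume.sum_mem_polytopes Finset.univ hA
    choose u hu using fun i => LatticeVolume.exists_nat_factorial_mul_volume (hA i)
    obtain ⟨w, hw⟩ := LatticeVolume.exists_nat_factorial_mul_volume hS
    refine ⟨w, u, ?_, fun i => ?_, LatticeVolume.volume_sum_modEq hp hd _ hA hu hw⟩
    · rw [← hw, Finset.sum_congr rfl fun i _ => hPA i, LatticeVolume.sum_image_add_eq]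
      exact LatticeVolume.normalizedVolume_image hT hTlat
        (LatticeVolume.sum_mem_intLattice _ hv) (LatticeVolume.nonempty_of_mem_polytopes hS)
    · rw [← hu, hPA]
      exact LatticeVolume.normalizedVolume_image hT hTlat (hv i)
        (LatticeVolume.nonempty_of_mem_polytopes (hA i))
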